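/- **Setting.** Let $d\ge 1$ and let $n$ be odd. Take $J_0\ge n$, $J_k=2^kJ_0$, $h_k=1/J_k$, and let $\mathcal G^k=\{(i_1h_k,\dots,i_dh_k): 0\le i_a\le J_k\}\subset[0,1]^d$ be the nested uniform grids. Put $N_k=(J_k+1)^d$ and identify $\mathbb R^{N_k}$ with the real functions on $\mathcal G^k$, with the maximum norm $\|\cdot\|_\infty$. **Prediction.** For $d=1$ the linear operator $P_k^{k+1}:\mathbb R^{N_k}\to\mathbb R^{N_{k+1}}$ is given by $(P_k^{k+1}z)_{2i}=z_i$ for $0\le i\le J_k$, while for $0\le i<J_k$ the value $(P_k^{k+1}z)_{2i+1}$ is the value at the midpoint of the $i$-th and $(i+1)$-th coarse nodes of the polynomial of degree $\le n$ that interpolates $z$ at the $n+1$ coarse nodes $i-\frac{n-1}2,\dots,i+\frac{n+1}2$ if these lie in the grid, and otherwise at the $n+1$ coarse nodes closest to the boundary in question. For $d>1$, $P_k^{k+1}$ is the $d$-fold tensor product of the one-dimensional operator. Put $P_\ell^k=P_{k-1}^k\cdots P_\ell^{\ell+1}$ for $\ell<k$, and $P_k^k=I$. **Sub-optimal solutions.**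 Given $L\ge 0$, $F:\mathbb R^{N_L}\to\mathbb R$ and an initial guess $\bar z\in\mathbb R^{N_L}$, let $z^{L,0}=\bar z$ and, for $k=0,\dots,L$, let $$\varepsilon^k_*=\operatorname{argmin}\{F(z^{L,k}+P_k^L\varepsilon):\varepsilon\in\mathbb R^{N_k}\},\qquad z^{L,k+1}=z^{L,k}+P_k^L\varepsilon^k_* .$$ For a set $D\subset\mathbb R^{N_L}$ let $$\rho_{\min}(F,D)=\inf_{\xi\in D}\,\inf_{x\ne0}\frac{x^T\nabla^2F(\xi)x}{\|x\|_\infty^2},\qquad \rho_{\max}(F,D)=\sup_{\xi\in D}\,\sup_{x\ne0}\frac{x^T\nabla^2F(\xi)x}{\|x\|_\infty^2}.$$ **Statement.** Let $f,g\in C^{n+1}([0,1]^d)$. There is a constant $C>0$, depending only on $d,n,J_0,f,g$ (in particular independent of $L$, $\ell$ and $F$), with the following property. Let $L\ge 0$ and let $F\in C^2(\mathbb R^{N_L},\mathbb R)$ be convex and coercive, with $\nabla^2F(\xi)$ positive definite for every $\xi$. Suppose that the initial guess $\bar z$ and the minimizer $z_{\min}$ of $F$ are the point values on $\mathcal G^L$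 of $f$ and of $g$, respectively. Then the corrections $\varepsilon^k_*$ ($0\le k\le L$) and the sub-optimal solutions $z^{L,k}$ ($0\le k\le L+1$) exist and are unique. Moreover, for every compact convex set $D\subset\mathbb R^{N_L}$ which contains $z^{L,0},\dots,z^{L,L+1}$ and the points $\bar z+P_\ell^L\big((g-f)|_{\mathcal G^\ell}\big)$, $0\le\ell\le L$, one has, with $C_{F,D}=C\sqrt{\rho_{\max}(F,D)/\rho_{\min}(F,D)}$ and for all $0\le\ell<L$, 1. $\|z_{\min}-z^{L,\ell+1}\|_\infty\le C_{F,D}\,h_{\ell+1}^{\,n+1}$, 2. $\|z^{L,\ell+1}-z^{L,\ell}\|_\infty\le C_{F,D}\,h_\ell^{\,n+1}$, 3. $\|\varepsilon^\ell_*\|_\infty\le C_{F,D}\,h_\ell^{\,n+1}$. -/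

import Mathlib

open Set Filter Topology

noncomputable section

namespace MROpt

/-- Real grid functions on the uniform grid with `J + 1` nodes per coordinate of `[0,1]^d`.
The norm on this type is the maximum norm. -/
abbrev GridFn (d J : ℕ) : Type := (Fin d → Fin (J + 1)) → ℝ

/-- Number of cells per coordinate at level `k`: `J_k = 2^k J_0`. -/
abbrev cells (J₀ k : ℕ) : ℕ := J₀ * 2 ^ k

/-- Mesh width at level `k`: `h_k = 1 / J_k`. -/
def mesh (J₀ k : ℕ) : ℝ := 1 / (cells J₀ k : ℝ)

/-- Point values of `f` on the grid of level `k`. -/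
def sample {d : ℕ} (J₀ k : ℕ) (f : (Fin d → ℝ) → ℝ) : GridFn d (cells J₀ k) :=
  fun i => f (fun a => ((i a : ℕ) : ℝ) * mesh J₀ k)

/-- First node of the `(n + 1)`-point stencil used to predict the value midway between the coarse
nodes `i` and `i + 1` of a grid with nodes `0, …, J` (`n` odd, `n ≤ J`). It is the centred stencil
`i - (n-1)/2, …, i + (n+1)/2` when this fits into the grid (natural subtraction truncates at `0`),
and otherwise the `n + 1` nodes closest to the boundary in question. -/
def stencilStart (n J i : ℕ) : ℕ := min (i - (n - 1) / 2) (J - n)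

/-- Coefficient of the coarse value at node `j` in the one-dimensional prediction of the fine value
at node `m`. Even fine nodes are copied. At odd fine nodes, which lie at position `m / 2` in units
of the coarse mesh, the interpolating polynomial of degree `n` on the stencil is evaluated. -/
def predWeight (n J m j : ℕ) : ℝ :=
  if Even m then (if 2 * j = m then 1 else 0)
  else
    if j ∈ Finset.Icc (stencilStart n J (m / 2)) (stencilStart n J (m / 2) + n) then
      (Lagrange.basis (Finset.Icc (stencilStart n J (m / 2)) (stencilStart n J (m / 2) + n))
        (fun i : ℕ => (i : ℝ)) j).eval ((m : ℝ) / 2)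
    else 0

/-- The prediction operator `P_k^{k+1}`: the `d`-fold tensor product of the one-dimensional rule. -/
def predStep (d n J₀ k : ℕ) : GridFn d (cells J₀ k) →ₗ[ℝ] GridFn d (cells J₀ (k + 1)) :=
  Matrix.mulVecLin
    (Matrix.of fun (i : Fin d → Fin (cells J₀ (k + 1) + 1)) (j : Fin d → Fin (cells J₀ k + 1)) =>
      ∏ a, predWeight n (cells J₀ k) (i a : ℕ) (j a : ℕ))

/-- The recursive prediction `P_ℓ^k = P_{k-1}^k ⋯ P_ℓ^{ℓ+1}`, with `P_ℓ^ℓ` the identity. -/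
def pred (d n J₀ : ℕ) {ℓ k : ℕ} (h : ℓ ≤ k) :
    GridFn d (cells J₀ ℓ) →ₗ[ℝ] GridFn d (cells J₀ k) :=
  Nat.leRecOn (C := fun m => GridFn d (cells J₀ ℓ) →ₗ[ℝ] GridFn d (cells J₀ m)) h
    (fun {m} A => (predStep d n J₀ m).comp A) LinearMap.id

/-- Objective function of an auxiliary problem at level `k ≤ L` about the current point `z`:
`e ↦ F (z + P_k^L e)`. -/
def levelObjective {d : ℕ} (n J₀ : ℕ) {L k : ℕ} (h : k ≤ L)
    (F : GridFn d (cells J₀ L) → ℝ) (z : GridFn d (cells J₀ L)) (e : GridFn d (cells J₀ k)) : ℝ :=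
  F (z + pred d n J₀ h e)

/-- Data produced by the multilevel strategy: `z k` stands for `z^{L,k}`, `0 ≤ k ≤ L + 1`, and
`ε k` for the correction computed at level `k`, `0 ≤ k ≤ L`. -/
structure Iterates (d J₀ L : ℕ) where
  z : Fin (L + 2) → GridFn d (cells J₀ L)
  ε : (k : Fin (L + 1)) → GridFn d (cells J₀ (k : ℕ))

/-- `s` is the outcome of the multilevel strategy for the objective `F` and initial guess `zbar`:
`z^{L,0} = zbar`, the correction at level `k` minimizes the level-`k` objective function about
`z^{L,k}`, and `z^{L,k+1} = z^{L,k} + P_k^L ε^k`. -/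
def IsOutcome {d L : ℕ} (n J₀ : ℕ) (F : GridFn d (cells J₀ L) → ℝ) (zbar : GridFn d (cells J₀ L))
    (s : Iterates d J₀ L) : Prop :=
  s.z 0 = zbar ∧
  ∀ k : Fin (L + 1),
    IsMinOn (levelObjective n J₀ k.is_le F (s.z k.castSucc)) univ (s.ε k) ∧
    s.z k.succ = s.z k.castSucc + pred d n J₀ k.is_le (s.ε k)

/-- The quadratic form `xᵀ ∇²F(ξ) x`. -/
def hessForm {d J : ℕ} (F : GridFn d J → ℝ) (ξ x : GridFn d J) : ℝ :=
  iteratedFDeriv ℝ 2 F ξ (fun _ => x)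

/-- The values `xᵀ ∇²F(ξ) x / ‖x‖_∞²` for `ξ ∈ D` and `x ≠ 0`. -/
def hessQuotients {d J : ℕ} (F : GridFn d J → ℝ) (D : Set (GridFn d J)) : Set ℝ :=
  {r | ∃ ξ ∈ D, ∃ x : GridFn d J, x ≠ 0 ∧ r = hessForm F ξ x / ‖x‖ ^ 2}

/-- `ρ_min(F, D)`. -/
def rhoMin {d J : ℕ} (F : GridFn d J → ℝ) (D : Set (GridFn d J)) : ℝ := sInf (hessQuotients F D)

/-- `ρ_max(F, D)`. -/
def rhoMax {d J : ℕ} (F : GridFn d J → ℝ) (D : Set (GridFn d J)) : ℝ := sSup (hessQuotients F D)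

end MROpt

end

namespace MROpt

/-! ### Interpolation weights at the midpoint of a centred stencil -/

/-! Put `u = g - f`. The ranges of `P_k^L` grow with `k`, so `z^{L,ℓ+1}` minimizes `F` over the
whole affine space `zbar + range P_ℓ^L`, and in particular does at least as well as `y = zbar +
P_ℓ^L u`. Second-order Taylor expansion at `zmin`, where the gradient vanishes, turns this into
`ρ_min ‖z^{L,ℓ+1} - zmin‖² ≤ ρ_max ‖y - zmin‖²` (`norm_sub_le_of_le`), and `y - zmin` is the error
of predicting samples of `u` from level `ℓ`. It remains to bound that error by `O(h_ℓ^(n+1))`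
uniformly in `L` (`exists_norm_pred_sample_sub_le`). One step is consistent because interpolation is
exact on polynomials of degree at most `n`. The one-step errors can be accumulated because the
recursive predictions are uniformly bounded (`norm_pred_le`).

Stability is the deep point. On the integers, the symbol of the centred rule is `1 + oddSymbol n θ`.
The derivative of `oddSymbol n` is a multiple of `sin θ ^ n`, so it is monotone on `[0, π]` between
the values `1` and `-1`, and the symbol is nonnegative. The iterated impulse response therefore has,
up to a phase, a nonnegative trigonometric polynomial as its transform, and each of its coefficients
is at most the mean, which is `1` because the scheme interpolates (`abs_subdiv_iterate_single_le`).
Boundary stencils are absorbed by extending grid data to all integers with the two boundary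
interpolation polynomials: polynomial reproduction makes the centred rule agree there with the
one-sided one (`sum_predWeight_mul`). Tensor products handle `d > 1`. -/

lemma prod_erase_range_sub (n s : ℕ) (hs : s ≤ n) :
    ∏ j ∈ (Finset.range (n + 1)).erase s, ((s : ℝ) - (j : ℝ))
      = (-1) ^ (n - s) * s.factorial * (n - s).factorial := by
  induction n, hs using Nat.le_induction with
  | base =>
    have h : (Finset.range (s + 1)).erase s = Finset.range s := by
      ext j; simp only [Finset.mem_erase, Finset.mem_range]; omega
    rw [h, ← Finset.prod_range_reflect, ← Finset.prod_range_add_one_eq_factorial]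
    simp only [Nat.sub_self, pow_zero, one_mul, Nat.factorial_zero, Nat.cast_one, mul_one]
    push_cast
    refine Finset.prod_congr rfl fun j hj => ?_
    have hj' := Finset.mem_range.1 hj
    rw [show s - 1 - j = s - (j + 1) by omega, Nat.cast_sub (by omega)]
    push_cast; ring
  | succ n hn ih =>
    have h : (Finset.range (n + 1 + 1)).erase s
        = insert (n + 1) ((Finset.range (n + 1)).erase s) := by
      ext j; simp only [Finset.mem_erase, Finset.mem_range, Finset.mem_insert]; omega
    rw [h, Finset.prod_insert (by simp), ih, Nat.succ_sub hn, Nat.succ_eq_add_one,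
      Nat.factorial_succ, pow_succ]
    push_cast [Nat.cast_sub hn]
    ring

lemma nodalWeight_range (n s : ℕ) (hs : s ≤ n) :
    Lagrange.nodalWeight (Finset.range (n + 1)) (fun i : ℕ => (i : ℝ)) s
      = (-1) ^ (n - s) * n.choose s / n.factorial := by
  rw [Lagrange.nodalWeight, Finset.prod_inv_distrib, prod_erase_range_sub n s hs,
    Nat.cast_choose ℝ hs]
  have h1 : ((-1 : ℝ) ^ (n - s)) * (-1) ^ (n - s) = 1 := by
    rw [← mul_pow]; simp
  have h2 : (n.factorial : ℝ) ≠ 0 := by positivity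
  have h3 : (s.factorial : ℝ) ≠ 0 := by positivity
  have h4 : ((n - s).factorial : ℝ) ≠ 0 := by positivity
  have h5 : ((-1 : ℝ) ^ (n - s)) ≠ 0 := pow_ne_zero _ (by norm_num)
  field_simp
  linear_combination -h1

lemma sum_eval_mul_basis {s : Finset ℕ} {p : Polynomial ℝ} (hp : p.degree < s.card) (x : ℝ) :
    ∑ i ∈ s, p.eval (i : ℝ) * (Lagrange.basis s (fun i : ℕ => (i : ℝ)) i).eval x = p.eval x := by
  have hinj : Set.InjOn (fun i : ℕ => (i : ℝ)) (s : Set ℕ) := fun a _ b _ h =>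
    Nat.cast_injective h
  conv_rhs => rw [Lagrange.eq_interpolate hinj hp]
  rw [Lagrange.interpolate_apply, Polynomial.eval_finsetSum]
  simp

/-- The weight of the `s`-th node of `0, …, n` in the interpolation at the midpoint `n / 2`. -/
noncomputable def midWeight (n s : ℕ) : ℝ :=
  (Lagrange.basis (Finset.range (n + 1)) (fun i : ℕ => (i : ℝ)) s).eval ((n : ℝ) / 2)

lemma sum_midWeight_mul_eval {n : ℕ} {p : Polynomial ℝ} (hp : p.degree < (n + 1 : ℕ)) :
    ∑ s ∈ Finset.range (n + 1), midWeight n s * p.eval (s : ℝ) = p.eval ((n : ℝ) / 2) := by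
  rw [← sum_eval_mul_basis (s := Finset.range (n + 1)) (by simpa using hp)]
  exact Finset.sum_congr rfl fun _ _ => mul_comm _ _

lemma sum_midWeight (n : ℕ) : ∑ s ∈ Finset.range (n + 1), midWeight n s = 1 := by
  have h := sum_midWeight_mul_eval (n := n) (p := 1)
    (by rw [Polynomial.degree_one]; exact_mod_cast Nat.succ_pos n)
  simpa using h

/-- The first barycentric formula at `n / 2`, which is not a node because `n` is odd. The factor `2
s - n` is exactly what differentiating `cos ((n - 2 s) θ)` produces, so the derivative of the symbol
becomes a plain binomial sum. -/
lemma exists_midWeight_eq {n : ℕ} (hn : Odd n) :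
    ∃ κ : ℝ, ∀ s ≤ n, (2 * (s : ℝ) - n) * midWeight n s = κ * ((-1) ^ s * n.choose s) := by
  refine ⟨2 * (Lagrange.nodal (Finset.range (n + 1)) (fun i : ℕ => (i : ℝ))).eval ((n : ℝ) / 2)
    / n.factorial, fun s hs => ?_⟩
  have hne : (n : ℝ) / 2 - s ≠ 0 := by
    intro h
    have h' : n = 2 * s := by
      have : (n : ℝ) = 2 * s := by linarith
      exact_mod_cast this
    rcases hn with ⟨k, hk⟩; omega
  have hsign : (-1 : ℝ) ^ (n - s) = -(-1) ^ s := by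
    have h1 : (-1 : ℝ) ^ (n - s) * (-1) ^ s = -1 := by
      rw [← pow_add, Nat.sub_add_cancel hs, hn.neg_one_pow]
    have h2 : (-1 : ℝ) ^ s * (-1) ^ s = 1 := by rw [← mul_pow]; simp
    linear_combination (-1 : ℝ) ^ s * h1 - (-1 : ℝ) ^ (n - s) * h2
  rw [midWeight, Lagrange.eval_basis_not_at_node (by simp; omega)
    (fun h => hne (sub_eq_zero.2 h)), nodalWeight_range n s hs, hsign]
  rw [show 2 * (s : ℝ) - n = -2 * ((n : ℝ) / 2 - s) by ring]
  generalize (n : ℝ) / 2 - s = y at hne ⊢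
  linear_combination 2 * (Lagrange.nodal (Finset.range (n + 1)) (fun i : ℕ => (i : ℝ))).eval
    ((n : ℝ) / 2) * ((-1) ^ s * n.choose s / n.factorial) * mul_inv_cancel₀ hne

lemma midWeight_symm {n s : ℕ} (hn : Odd n) (hs : s ≤ n) :
    midWeight n (n - s) = midWeight n s := by
  obtain ⟨κ, hκ⟩ := exists_midWeight_eq hn
  have h1 := hκ s hs
  have h2 := hκ (n - s) (Nat.sub_le _ _)
  rw [Nat.choose_symm hs, Nat.cast_sub hs] at h2
  have hne : 2 * (s : ℝ) - n ≠ 0 := by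
    intro h
    have h' : n = 2 * s := by
      have : (n : ℝ) = 2 * s := by linarith
      exact_mod_cast this
    rcases hn with ⟨k, hk⟩; omega
  have hsign : (-1 : ℝ) ^ (n - s) = -(-1) ^ s := by
    have h1 : (-1 : ℝ) ^ (n - s) * (-1) ^ s = -1 := by
      rw [← pow_add, Nat.sub_add_cancel hs, hn.neg_one_pow]
    have h2 : (-1 : ℝ) ^ s * (-1) ^ s = 1 := by rw [← mul_pow]; simp
    linear_combination (-1 : ℝ) ^ s * h1 - (-1 : ℝ) ^ (n - s) * h2
  rw [hsign] at h2
  apply mul_left_cancel₀ hne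
  linear_combination -h2 - h1

/-! ### Nonnegativity of the symbol -/

/-- The trigonometric polynomial of the midpoint weights. -/
noncomputable def oddSymbol (n : ℕ) (θ : ℝ) : ℝ :=
  ∑ s ∈ Finset.range (n + 1), midWeight n s * Real.cos (((n : ℝ) - 2 * s) * θ)

/-- Imaginary part of the binomial expansion of `(exp (iθ) - exp (-iθ)) ^ n = (2 i sin θ) ^ n`. -/
lemma sum_choose_mul_sin (n : ℕ) (θ : ℝ) :
    ∑ s ∈ Finset.range (n + 1), (-1) ^ s * (n.choose s : ℝ) * Real.sin (((n : ℝ) - 2 * s) * θ)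
      = (2 ^ n * (Complex.I ^ n).im) * Real.sin θ ^ n := by
  have h := add_pow (-Complex.exp (-(θ * Complex.I))) (Complex.exp (θ * Complex.I)) n
  have h1 : -Complex.exp (-(θ * Complex.I)) + Complex.exp (θ * Complex.I)
      = ((2 * Real.sin θ : ℝ) : ℂ) * Complex.I := by
    push_cast
    rw [Complex.exp_mul_I, ← neg_mul, Complex.exp_mul_I, Complex.cos_neg, Complex.sin_neg]
    ring
  rw [h1, mul_pow, ← Complex.ofReal_pow] at h
  have him := congrArg Complex.im h
  rw [Complex.im_ofReal_mul] at him
  rw [Complex.im_sum] at him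
  rw [mul_pow] at him
  rw [mul_right_comm, him]
  refine Finset.sum_congr rfl fun s hs => ?_
  have hs' : s ≤ n := by have := Finset.mem_range.1 hs; omega
  have h2 : (-Complex.exp (-(θ * Complex.I))) ^ s * Complex.exp (θ * Complex.I) ^ (n - s)
      * (n.choose s : ℂ) = (((-1) ^ s * (n.choose s : ℝ) : ℝ) : ℂ)
        * Complex.exp (((((n : ℝ) - 2 * s) * θ : ℝ) : ℂ) * Complex.I) := by
    rw [neg_pow, ← Complex.exp_nat_mul, ← Complex.exp_nat_mul, mul_assoc ((-1) ^ s),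
      ← Complex.exp_add, Nat.cast_sub hs']
    push_cast
    rw [mul_right_comm]
    congr 2
    ring
  rw [h2, Complex.im_ofReal_mul, Complex.exp_ofReal_mul_I_im]

lemma exists_hasDerivAt_oddSymbol {n : ℕ} (hn : Odd n) :
    ∃ κ : ℝ, ∀ θ, HasDerivAt (oddSymbol n) (κ * Real.sin θ ^ n) θ := by
  obtain ⟨κ, hκ⟩ := exists_midWeight_eq hn
  refine ⟨κ * (2 ^ n * (Complex.I ^ n).im), fun θ => ?_⟩
  have h : HasDerivAt (oddSymbol n) (∑ s ∈ Finset.range (n + 1),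
      midWeight n s * (-Real.sin (((n : ℝ) - 2 * s) * θ) * (((n : ℝ) - 2 * s) * 1))) θ := by
    unfold oddSymbol
    refine HasDerivAt.fun_sum fun s _ => HasDerivAt.const_mul _ ?_
    exact ((hasDerivAt_id θ).const_mul _).cos
  convert h using 1
  rw [mul_assoc, ← sum_choose_mul_sin, Finset.mul_sum]
  refine Finset.sum_congr rfl fun s hs => ?_
  have := hκ s (by have := Finset.mem_range.1 hs; omega)
  linear_combination -Real.sin (((n : ℝ) - 2 * s) * θ) * this

lemma oddSymbol_zero (n : ℕ) : oddSymbol n 0 = 1 := by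
  simp [oddSymbol, sum_midWeight]

lemma oddSymbol_pi {n : ℕ} (hn : Odd n) : oddSymbol n Real.pi = -1 := by
  rw [oddSymbol, ← sum_midWeight n, ← Finset.sum_neg_distrib]
  refine Finset.sum_congr rfl fun s _ => ?_
  have : Real.cos (((n : ℝ) - 2 * s) * Real.pi) = -1 := by
    have h := Real.cos_sub_nat_mul_two_pi (n * Real.pi) s
    rw [Real.cos_nat_mul_pi, hn.neg_one_pow] at h
    rw [← h]; ring_nf
  rw [this]; ring

/-- Each summand is a Chebyshev polynomial in `cos θ`; this reduces bounds on the symbol to `[0,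
π]`, where `sin` is nonnegative. -/
lemma oddSymbol_arccos_cos (n : ℕ) (θ : ℝ) :
    oddSymbol n (Real.arccos (Real.cos θ)) = oddSymbol n θ := by
  refine Finset.sum_congr rfl fun s _ => ?_
  have h : ∀ φ : ℝ, Real.cos (((n : ℝ) - 2 * s) * φ)
      = (Polynomial.Chebyshev.T ℝ ((n : ℤ) - 2 * s)).eval (Real.cos φ) := fun φ => by
    rw [Polynomial.Chebyshev.T_real_cos]; push_cast; rfl
  rw [h, h, Real.cos_arccos (Real.neg_one_le_cos θ) (Real.cos_le_one θ)]

lemma neg_one_le_oddSymbol {n : ℕ} (hn : Odd n) (θ : ℝ) : -1 ≤ oddSymbol n θ := by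
  rw [← oddSymbol_arccos_cos]
  set φ := Real.arccos (Real.cos θ) with hφ
  have hφm : φ ∈ Set.Icc 0 Real.pi := ⟨Real.arccos_nonneg _, Real.arccos_le_pi _⟩
  obtain ⟨κ, hκ⟩ := exists_hasDerivAt_oddSymbol hn
  have hc : ContinuousOn (oddSymbol n) (Set.Icc 0 Real.pi) :=
    fun x _ => (hκ x).continuousAt.continuousWithinAt
  have hd : DifferentiableOn ℝ (oddSymbol n) (interior (Set.Icc 0 Real.pi)) :=
    fun x _ => (hκ x).differentiableAt.differentiableWithinAt
  have hs : ∀ x ∈ interior (Set.Icc 0 Real.pi), 0 ≤ Real.sin x ^ n := fun x hx =>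
    pow_nonneg (Real.sin_nonneg_of_mem_Icc (interior_subset hx)) _
  -- The sign of `κ` need not be known: monotonicity in either direction bounds the function below
  -- by one of its endpoint values `1` and `-1`.
  rcases le_total 0 κ with h | h
  · have hm := monotoneOn_of_deriv_nonneg (convex_Icc 0 Real.pi) hc hd fun x hx => by
      rw [(hκ x).deriv]; exact mul_nonneg h (hs x hx)
    have := hm (Set.left_mem_Icc.2 Real.pi_pos.le) hφm hφm.1
    rw [oddSymbol_zero] at this
    linarith
  · have hm := antitoneOn_of_deriv_nonpos (convex_Icc 0 Real.pi) hc hd fun x hx => by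
      rw [(hκ x).deriv]; exact mul_nonpos_of_nonpos_of_nonneg h (hs x hx)
    have := hm hφm (Set.right_mem_Icc.2 Real.pi_pos.le) hφm.2
    rwa [oddSymbol_pi hn] at this

/-- The sine parts cancel under `s ↦ n - s` by the symmetry of the weights, so the symbol is real.
-/
lemma sum_midWeight_mul_exp {n : ℕ} (hn : Odd n) (θ : ℝ) :
    ∑ s ∈ Finset.range (n + 1),
        (midWeight n s : ℂ) * Complex.exp (((((n : ℝ) - 2 * s) * θ : ℝ) : ℂ) * Complex.I)
      = (oddSymbol n θ : ℂ) := by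
  apply Complex.ext
  · rw [Complex.re_sum, Complex.ofReal_re]
    refine Finset.sum_congr rfl fun s _ => ?_
    rw [Complex.re_ofReal_mul, Complex.exp_ofReal_mul_I_re]
  · rw [Complex.im_sum, Complex.ofReal_im]
    have h : ∀ s, ((midWeight n s : ℂ)
        * Complex.exp (((((n : ℝ) - 2 * s) * θ : ℝ) : ℂ) * Complex.I)).im
        = midWeight n s * Real.sin (((n : ℝ) - 2 * s) * θ) := fun s => by
      rw [Complex.im_ofReal_mul, Complex.exp_ofReal_mul_I_im]
    simp only [h]
    have hr := Finset.sum_range_reflect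
      (fun s => midWeight n s * Real.sin (((n : ℝ) - 2 * s) * θ)) (n + 1)
    have hr' : ∑ s ∈ Finset.range (n + 1), midWeight n (n + 1 - 1 - s)
          * Real.sin (((n : ℝ) - 2 * ((n + 1 - 1 - s : ℕ) : ℝ)) * θ)
        = -∑ s ∈ Finset.range (n + 1), midWeight n s * Real.sin (((n : ℝ) - 2 * s) * θ) := by
      rw [← Finset.sum_neg_distrib]
      refine Finset.sum_congr rfl fun s hs => ?_
      have hs' : s ≤ n := by have := Finset.mem_range.1 hs; omega
      rw [Nat.add_sub_cancel, midWeight_symm hn hs', Nat.cast_sub hs', ← mul_neg, ← Real.sin_neg]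
      congr 2; ring
    rw [hr'] at hr
    linarith

/-! ### The interpolatory subdivision scheme on the integers -/

/-- The subdivision operator with the centred `(n + 1)`-point rule. -/
noncomputable def subdiv (n : ℕ) : (ℤ → ℝ) →ₗ[ℝ] (ℤ → ℝ) where
  toFun u i := if Even i then u (i / 2)
    else ∑ s ∈ Finset.range (n + 1), midWeight n s * u ((i - n) / 2 + s)
  map_add' u v := by
    ext i
    by_cases h : Even i <;> simp [h, mul_add, Finset.sum_add_distrib]
  map_smul' c u := by
    ext i
    by_cases h : Even i <;> simp [h, Finset.mul_sum, mul_left_comm]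

lemma subdiv_two_mul (n : ℕ) (u : ℤ → ℝ) (i : ℤ) : subdiv n u (2 * i) = u i := by
  simp [subdiv]

lemma subdiv_of_odd (n : ℕ) (u : ℤ → ℝ) {i : ℤ} (hi : ¬ Even i) :
    subdiv n u i = ∑ s ∈ Finset.range (n + 1), midWeight n s * u ((i - n) / 2 + s) := by
  simp [subdiv, hi]

/-- The subdivision operator on finitely supported sequences. -/
noncomputable def finSubdiv (n : ℕ) : (ℤ →₀ ℝ) →ₗ[ℝ] (ℤ →₀ ℝ) :=
  Finsupp.linearCombination ℝ fun j => Finsupp.single (2 * j) 1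
    + ∑ s ∈ Finset.range (n + 1), Finsupp.single (2 * j + (n - 2 * s)) (midWeight n s)

lemma coe_finSubdiv {n : ℕ} (hn : Odd n) (c : ℤ →₀ ℝ) :
    (finSubdiv n c : ℤ → ℝ) = subdiv n c := by
  induction c using Finsupp.induction_linear with
  | zero => simp
  | add c₁ c₂ h₁ h₂ => rw [map_add, Finsupp.coe_add, h₁, h₂, Finsupp.coe_add, map_add]
  | single j x =>
    ext i
    have hn' : Odd (n : ℤ) := by exact_mod_cast hn
    rw [finSubdiv, Finsupp.linearCombination_single, Finsupp.smul_apply, Finsupp.add_apply,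
      Finsupp.finsetSum_apply]
    by_cases hi : Even i
    · obtain ⟨p, rfl⟩ := hi
      rw [← two_mul, subdiv_two_mul, Finset.sum_eq_zero]
      · by_cases h : p = j
        · simp [h]
        · rw [Finsupp.single_eq_of_ne (by omega), Finsupp.single_eq_of_ne h]; simp
      · intro s _
        rw [Finsupp.single_eq_of_ne]
        obtain ⟨k, hk⟩ := hn'
        omega
    · have hio := Int.not_even_iff_odd.1 hi
      rw [subdiv_of_odd n _ hi, Finsupp.single_eq_of_ne
        (by rintro rfl; exact hi (even_two_mul j)), zero_add, Finset.smul_sum]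
      refine Finset.sum_congr rfl fun s _ => ?_
      obtain ⟨k, hk⟩ := hn'
      obtain ⟨p, rfl⟩ := hio
      by_cases h : 2 * p + 1 = 2 * j + ((n : ℤ) - 2 * s)
      · rw [h, show (2 * j + ((n : ℤ) - 2 * s) - n) / 2 + s = j by omega]
        simp [mul_comm]
      · rw [Finsupp.single_eq_of_ne h, Finsupp.single_eq_of_ne (by omega)]; simp

lemma coe_finSubdiv_iterate {n : ℕ} (hn : Odd n) (c : ℤ →₀ ℝ) (m : ℕ) :
    ((finSubdiv n)^[m] c : ℤ → ℝ) = (subdiv n)^[m] c := by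
  induction m with
  | zero => rfl
  | succ m ih => rw [Function.iterate_succ_apply', Function.iterate_succ_apply',
      coe_finSubdiv hn, ih]

/-- The trigonometric polynomial with given coefficients. -/
noncomputable def trigEval (θ : ℝ) : (ℤ →₀ ℝ) →ₗ[ℝ] ℂ :=
  Finsupp.linearCombination ℝ fun k : ℤ => Complex.exp (((k * θ : ℝ) : ℂ) * Complex.I)

lemma trigEval_single (θ : ℝ) (k : ℤ) (x : ℝ) :
    trigEval θ (Finsupp.single k x) = x * Complex.exp (((k * θ : ℝ) : ℂ) * Complex.I) := by
  simp [trigEval, Finsupp.linearCombination_single]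

/-- Upsampling doubles the frequency and the filter multiplies by its symbol, so iteration yields a
product of nonnegative factors. -/
lemma trigEval_finSubdiv {n : ℕ} (hn : Odd n) (θ : ℝ) (c : ℤ →₀ ℝ) :
    trigEval θ (finSubdiv n c) = ((1 + oddSymbol n θ : ℝ) : ℂ) * trigEval (2 * θ) c := by
  induction c using Finsupp.induction_linear with
  | zero => simp
  | add c₁ c₂ h₁ h₂ => rw [map_add, map_add, h₁, h₂, map_add, mul_add]
  | single j x =>
    rw [finSubdiv, Finsupp.linearCombination_single, map_smul, map_add, map_sum,
      trigEval_single, trigEval_single]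
    simp only [trigEval_single]
    have h : ∀ s ∈ Finset.range (n + 1), (midWeight n s : ℂ)
        * Complex.exp (((((2 * j + ((n : ℤ) - 2 * s) : ℤ) : ℝ) * θ : ℝ) : ℂ) * Complex.I)
        = Complex.exp (((j * (2 * θ) : ℝ) : ℂ) * Complex.I) * ((midWeight n s : ℂ)
          * Complex.exp (((((n : ℝ) - 2 * s) * θ : ℝ) : ℂ) * Complex.I)) := fun s _ => by
      rw [mul_left_comm, ← Complex.exp_add]
      congr 2
      push_cast
      ring
    rw [Finset.sum_congr rfl h, ← Finset.mul_sum, sum_midWeight_mul_exp hn, Complex.real_smul]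
    rw [show (((2 * j : ℤ) : ℝ) * θ) = j * (2 * θ) by push_cast; ring]
    push_cast
    ring

lemma trigEval_iterate {n : ℕ} (hn : Odd n) (m : ℕ) (θ : ℝ) (j : ℤ) :
    trigEval θ ((finSubdiv n)^[m] (Finsupp.single j 1))
      = ((∏ k ∈ Finset.range m, (1 + oddSymbol n (2 ^ k * θ)) : ℝ) : ℂ)
        * Complex.exp (((j * (2 ^ m * θ) : ℝ) : ℂ) * Complex.I) := by
  induction m generalizing θ with
  | zero => simp [trigEval_single]
  | succ m ih =>
    rw [Function.iterate_succ_apply', trigEval_finSubdiv hn, ih, Finset.prod_range_succ',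
      ← mul_assoc, ← Complex.ofReal_mul, mul_comm (1 + oddSymbol n θ)]
    simp only [pow_succ, mul_assoc, pow_zero, one_mul]

lemma continuous_trigEval (c : ℤ →₀ ℝ) : Continuous fun θ => trigEval θ c := by
  simp only [trigEval, Finsupp.linearCombination_apply, Finsupp.sum]
  fun_prop

lemma integral_exp_int_mul (k : ℤ) :
    ∫ θ in (0 : ℝ)..2 * Real.pi, Complex.exp (((k * θ : ℝ) : ℂ) * Complex.I)
      = if k = 0 then 2 * (Real.pi : ℂ) else 0 := by
  by_cases hk : k = 0
  · simp [hk]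
  · have hc : (k : ℂ) * Complex.I ≠ 0 :=
      mul_ne_zero (by exact_mod_cast hk) Complex.I_ne_zero
    have h := integral_exp_mul_complex (a := 0) (b := 2 * Real.pi) hc
    have he : Complex.exp ((k : ℂ) * Complex.I * ((2 * Real.pi : ℝ) : ℂ)) = 1 := by
      rw [Complex.exp_eq_one_iff]
      exact ⟨k, by push_cast; ring⟩
    rw [he, Complex.ofReal_zero, mul_zero, Complex.exp_zero, sub_self, zero_div] at h
    rw [if_neg hk, ← h]
    refine intervalIntegral.integral_congr fun θ _ => ?_
    congr 1
    push_cast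
    ring

lemma integral_trigEval_mul_exp (c : ℤ →₀ ℝ) (k : ℤ) :
    ∫ θ in (0 : ℝ)..2 * Real.pi,
        trigEval θ c * Complex.exp (((((-k : ℤ) : ℝ) * θ : ℝ) : ℂ) * Complex.I)
      = 2 * Real.pi * (c k : ℂ) := by
  have hint : ∀ c : ℤ →₀ ℝ, IntervalIntegrable (fun θ : ℝ => trigEval θ c
      * Complex.exp (((((-k : ℤ) : ℝ) * θ : ℝ) : ℂ) * Complex.I)) MeasureTheory.volume 0
        (2 * Real.pi) := fun c =>
    ((continuous_trigEval c).mul (by fun_prop)).intervalIntegrable _ _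
  induction c using Finsupp.induction_linear with
  | zero => simp
  | add c₁ c₂ h₁ h₂ =>
    simp only [map_add, add_mul]
    rw [intervalIntegral.integral_add (hint c₁) (hint c₂), h₁, h₂, Finsupp.add_apply]
    push_cast
    ring
  | single j x =>
    have h : ∀ θ : ℝ, trigEval θ (Finsupp.single j x)
        * Complex.exp (((((-k : ℤ) : ℝ) * θ : ℝ) : ℂ) * Complex.I)
        = x * Complex.exp (((((j - k : ℤ) : ℝ) * θ : ℝ) : ℂ) * Complex.I) := fun θ => by
      rw [trigEval_single, mul_assoc, ← Complex.exp_add]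
      congr 2
      push_cast
      ring
    simp only [h]
    rw [intervalIntegral.integral_const_mul, integral_exp_int_mul]
    by_cases hjk : j = k
    · simp [hjk, mul_comm]
    · rw [if_neg (sub_ne_zero.2 hjk), Finsupp.single_eq_of_ne (Ne.symm hjk)]; simp

lemma subdiv_iterate_two_pow_mul (n m : ℕ) (u : ℤ → ℝ) (i : ℤ) :
    (subdiv n)^[m] u (2 ^ m * i) = u i := by
  induction m with
  | zero => simp
  | succ m ih => rw [Function.iterate_succ_apply', pow_succ', mul_assoc, subdiv_two_mul, ih]

/-- The iterated subdivision of a unit impulse is bounded by one: its symbol is, up to a factor of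
modulus one, nonnegative. -/
lemma abs_subdiv_iterate_single_le {n : ℕ} (hn : Odd n) (m : ℕ) (i j : ℤ) :
    |(subdiv n)^[m] (Finsupp.single j (1 : ℝ)) i| ≤ 1 := by
  set r : ℝ → ℝ := fun θ => ∏ k ∈ Finset.range m, (1 + oddSymbol n (2 ^ k * θ)) with hr
  have hr0 : ∀ θ, 0 ≤ r θ := fun θ => Finset.prod_nonneg fun k _ => by
    linarith [neg_one_le_oddSymbol hn (2 ^ k * θ)]
  -- For the impulse at `0` the phase is trivial. Its coefficient at `0` stays `1` because old nodes
  -- are copied, and this fixes the integral of `r` as `2π`.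
  have h0 := integral_trigEval_mul_exp ((finSubdiv n)^[m] (Finsupp.single 0 1)) 0
  have h1 : ((finSubdiv n)^[m] (Finsupp.single 0 1)) 0 = (1 : ℝ) := by
    rw [coe_finSubdiv_iterate hn]
    have := subdiv_iterate_two_pow_mul n m (Finsupp.single (0 : ℤ) (1 : ℝ)) 0
    rw [mul_zero] at this
    rw [this, Finsupp.single_eq_same]
  have h2 : ∫ θ in (0 : ℝ)..2 * Real.pi, r θ = 2 * Real.pi := by
    rw [h1] at h0
    simp only [trigEval_iterate hn, neg_zero, Int.cast_zero, zero_mul, Complex.ofReal_zero,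
      Complex.exp_zero, mul_one] at h0
    rw [intervalIntegral.integral_ofReal, Complex.ofReal_one, mul_one] at h0
    exact Complex.ofReal_injective (h0.trans (by push_cast; rfl))
  -- A general coefficient is the integral of the same `r` against a unimodular factor.
  have h3 := integral_trigEval_mul_exp ((finSubdiv n)^[m] (Finsupp.single j 1)) i
  have h4 := intervalIntegral.norm_integral_le_integral_norm (μ := MeasureTheory.volume)
    (f := fun θ : ℝ => trigEval θ ((finSubdiv n)^[m] (Finsupp.single j 1))
      * Complex.exp (((((-i : ℤ) : ℝ) * θ : ℝ) : ℂ) * Complex.I))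
    (a := 0) (b := 2 * Real.pi) (by positivity)
  have h5 : ∀ θ : ℝ, ‖trigEval θ ((finSubdiv n)^[m] (Finsupp.single j 1))
      * Complex.exp (((((-i : ℤ) : ℝ) * θ : ℝ) : ℂ) * Complex.I)‖ = r θ := fun θ => by
    rw [trigEval_iterate hn, norm_mul, norm_mul, Complex.norm_exp_ofReal_mul_I,
      Complex.norm_exp_ofReal_mul_I, mul_one, mul_one, Complex.norm_real,
      Real.norm_of_nonneg (hr0 θ)]
  simp only [h5] at h4
  rw [h3, h2, coe_finSubdiv_iterate hn, norm_mul, Complex.norm_real, Real.norm_eq_abs] at h4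
  have h6 : ‖2 * (Real.pi : ℂ)‖ = 2 * Real.pi := by
    rw [norm_mul, Complex.norm_real, Real.norm_of_nonneg Real.pi_pos.le]; simp
  rw [h6] at h4
  exact le_of_mul_le_mul_left (by linarith) Real.two_pi_pos

/-- Domain of dependence: one step reaches `|2 p - i| ≤ n`, and the radii add up as `2 n (2^m - 1) +
n = n (2^(m+1) - 1)`. -/
lemma subdiv_iterate_congr {n : ℕ} (hn : Odd n) (m : ℕ) {u v : ℤ → ℝ} (i : ℤ)
    (h : ∀ j, |2 ^ m * j - i| ≤ n * (2 ^ m - 1) → u j = v j) :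
    (subdiv n)^[m] u i = (subdiv n)^[m] v i := by
  induction m generalizing i with
  | zero => exact h i (by simp)
  | succ m ih =>
    rw [Function.iterate_succ_apply', Function.iterate_succ_apply']
    have key : ∀ p, |2 * p - i| ≤ n → (subdiv n)^[m] u p = (subdiv n)^[m] v p := fun p hp => by
      refine ih p fun j hj => h j ?_
      rw [abs_le] at *
      rw [pow_succ]
      constructor <;> nlinarith
    by_cases hi : Even i
    · obtain ⟨p, rfl⟩ := hi
      rw [← two_mul, subdiv_two_mul, subdiv_two_mul]
      exact key p (by rw [← two_mul]; simp)
    · rw [subdiv_of_odd _ _ hi, subdiv_of_odd _ _ hi]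
      refine Finset.sum_congr rfl fun s hs => ?_
      rw [key]
      have hs' := Finset.mem_range.1 hs
      obtain ⟨k, hk⟩ := hn
      obtain ⟨p, rfl⟩ := Int.not_even_iff_odd.1 hi
      rw [abs_le]
      omega

lemma subdiv_iterate_sum (n m : ℕ) (t : Finset ℤ) (u : ℤ → ℝ) (i : ℤ) :
    (subdiv n)^[m] (∑ j ∈ t, u j • (Finsupp.single j (1 : ℝ) : ℤ → ℝ)) i
      = ∑ j ∈ t, u j * (subdiv n)^[m] (Finsupp.single j (1 : ℝ)) i := by
  rw [← Module.End.coe_pow, map_sum, Finset.sum_apply]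
  simp

/-- Uniform stability of the iterated subdivision scheme. -/
lemma abs_subdiv_iterate_le {n : ℕ} (hn : Odd n) (m : ℕ) {u : ℤ → ℝ} {B : ℝ} {J i : ℤ}
    (hi : 0 ≤ i) (hiJ : i ≤ 2 ^ m * J) (hu : ∀ j : ℤ, -(n : ℤ) ≤ j → j ≤ J + n → |u j| ≤ B) :
    |(subdiv n)^[m] u i| ≤ (2 * n + 1) * B := by
  set q := i / 2 ^ m with hq
  have hpow : (0 : ℤ) < 2 ^ m := by positivity
  have hq1 : 2 ^ m * q ≤ i := Int.mul_ediv_self_le hpow.ne'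
  have hq2 : i < 2 ^ m * q + 2 ^ m := Int.lt_mul_ediv_self_add hpow
  have hq0 : 0 ≤ q := Int.ediv_nonneg hi hpow.le
  have hqJ : q ≤ J := by
    by_contra hlt
    push Not at hlt
    nlinarith
  -- Only the `2 n + 1` coarse nodes within `n` of `q` influence the value at `i`; since `0 ≤ q ≤
  -- J`, they lie in the range where `u` is bounded.
  set t := Finset.Icc (q - n) (q + n)
  have hcongr : (subdiv n)^[m] u i
      = (subdiv n)^[m] (∑ j ∈ t, u j • (Finsupp.single j (1 : ℝ) : ℤ → ℝ)) i := by
    refine subdiv_iterate_congr hn m i fun j hj => ?_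
    have hjt : j ∈ t := by
      rw [abs_le] at hj
      have hn0 : (0 : ℤ) ≤ n := by positivity
      have hn1 : (1 : ℤ) ≤ n := by exact_mod_cast hn.pos
      rw [Finset.mem_Icc]
      constructor
      · by_contra hlt
        push Not at hlt
        nlinarith
      · by_contra hlt
        push Not at hlt
        nlinarith
    rw [Finset.sum_apply, Finset.sum_eq_single j]
    · simp
    · intro b _ hb
      simp [Finsupp.single_eq_of_ne (Ne.symm hb)]
    · exact fun h => absurd hjt h
  rw [hcongr, subdiv_iterate_sum]
  calc |∑ j ∈ t, u j * (subdiv n)^[m] (Finsupp.single j (1 : ℝ)) i|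
      ≤ ∑ j ∈ t, |u j * (subdiv n)^[m] (Finsupp.single j (1 : ℝ)) i| :=
        Finset.abs_sum_le_sum_abs _ _
    _ ≤ ∑ _j ∈ t, B := by
        refine Finset.sum_le_sum fun j hj => ?_
        have hj' := Finset.mem_Icc.1 hj
        rw [abs_mul]
        have h1 := hu j (by omega) (by omega)
        have h2 := abs_subdiv_iterate_single_le hn m i j
        nlinarith [abs_nonneg (u j)]
    _ = (2 * n + 1) * B := by
        rw [Finset.sum_const, Int.card_Icc, nsmul_eq_mul]
        congr 1
        rw [show q + n + 1 - (q - n) = ((2 * n + 1 : ℕ) : ℤ) by push_cast; ring, Int.toNat_natCast]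
        push_cast; ring

/-! ### Reduction of the rule on an interval to the rule on the integers -/

/-- `u` is a polynomial of degree at most `n` up to the node `n`, and from the node `J - n` on. -/
def PolyEnds (n : ℕ) (J : ℤ) (u : ℤ → ℝ) : Prop :=
  (∃ p : Polynomial ℝ, p.degree < (n + 1 : ℕ) ∧ ∀ j : ℤ, j ≤ n → u j = p.eval (j : ℝ)) ∧
  ∃ q : Polynomial ℝ, q.degree < (n + 1 : ℕ) ∧ ∀ j : ℤ, J - n ≤ j → u j = q.eval (j : ℝ)

lemma degree_comp_lt {n : ℕ} {p q : Polynomial ℝ} (hp : p.degree < (n + 1 : ℕ))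
    (hq : q.natDegree ≤ 1) : (p.comp q).degree < (n + 1 : ℕ) := by
  have h1 : p.natDegree ≤ n := by
    rcases eq_or_ne p 0 with rfl | h0
    · simp
    · exact Nat.lt_succ_iff.1 ((Polynomial.natDegree_lt_iff_degree_lt h0).2 hp)
  refine lt_of_le_of_lt Polynomial.degree_le_natDegree ?_
  have h2 : (p.comp q).natDegree ≤ n * 1 :=
    Polynomial.natDegree_comp_le.trans (Nat.mul_le_mul h1 hq)
  exact_mod_cast (by omega : (p.comp q).natDegree < n + 1)

lemma subdiv_eq_eval {n : ℕ} (hn : Odd n) {p : Polynomial ℝ} (hp : p.degree < (n + 1 : ℕ))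
    {u : ℤ → ℝ} {i : ℤ} (h : ∀ j : ℤ, |2 * j - i| ≤ n → u j = p.eval (j : ℝ)) :
    subdiv n u i = p.eval ((i : ℝ) / 2) := by
  by_cases hi : Even i
  · obtain ⟨k, rfl⟩ := hi
    rw [← two_mul, subdiv_two_mul, h k (by rw [← two_mul]; simp)]
    congr 1
    push_cast
    ring
  · rw [subdiv_of_odd n u hi]
    obtain ⟨k, hk⟩ := hn
    obtain ⟨m, hm⟩ := Int.not_even_iff_odd.1 hi
    have hc : (((i - n) / 2 : ℤ) : ℝ) = (i : ℝ) / 2 - n / 2 := by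
      have : 2 * ((i - n) / 2) = i - n := by omega
      have h2 : 2 * (((i - n) / 2 : ℤ) : ℝ) = i - n := by exact_mod_cast this
      linarith
    have hq := sum_midWeight_mul_eval (n := n)
      (p := p.comp (Polynomial.X + Polynomial.C ((i : ℝ) / 2 - n / 2)))
      (degree_comp_lt hp (by rw [Polynomial.natDegree_X_add_C]))
    simp only [Polynomial.eval_comp, Polynomial.eval_add, Polynomial.eval_X,
      Polynomial.eval_C] at hq
    rw [show (n : ℝ) / 2 + ((i : ℝ) / 2 - n / 2) = i / 2 by ring] at hq
    rw [← hq]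
    refine Finset.sum_congr rfl fun s hs => ?_
    have hs' := Finset.mem_range.1 hs
    rw [h _ (by rw [abs_le]; omega)]
    congr 2
    push_cast
    rw [hc]
    ring

/-- The end width `n` is self-reproducing: a stencil `|2 j - i| ≤ n` with `i ≤ n` uses only `j ≤ n`,
and one with `2 J - n ≤ i` uses only `J - n ≤ j`. The new end polynomials are the old ones at `x /
2`. -/
lemma PolyEnds.subdiv {n : ℕ} (hn : Odd n) {J : ℤ} {u : ℤ → ℝ} (h : PolyEnds n J u) :
    PolyEnds n (2 * J) (subdiv n u) := by
  obtain ⟨⟨p, hp, hpu⟩, q, hq, hqu⟩ := h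
  have hdeg : (Polynomial.C (1 / 2 : ℝ) * Polynomial.X).natDegree ≤ 1 :=
    (Polynomial.natDegree_C_mul_le _ _).trans Polynomial.natDegree_X_le
  refine ⟨⟨p.comp (Polynomial.C (1 / 2) * Polynomial.X), degree_comp_lt hp hdeg, fun j hj => ?_⟩,
    q.comp (Polynomial.C (1 / 2) * Polynomial.X), degree_comp_lt hq hdeg, fun j hj => ?_⟩
  · rw [subdiv_eq_eval hn hp fun i hi => hpu i (by rw [abs_le] at hi; omega)]
    simp [Polynomial.eval_comp, div_eq_inv_mul]
  · rw [subdiv_eq_eval hn hq fun i hi => hqu i (by rw [abs_le] at hi; omega)]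
    simp [Polynomial.eval_comp, div_eq_inv_mul]

lemma PolyEnds.subdiv_iterate {n : ℕ} (hn : Odd n) {J : ℤ} {u : ℤ → ℝ} (h : PolyEnds n J u)
    (m : ℕ) : PolyEnds n (2 ^ m * J) ((MROpt.subdiv n)^[m] u) := by
  induction m with
  | zero => simpa using h
  | succ m ih =>
    rw [Function.iterate_succ_apply', pow_succ', mul_assoc]
    exact ih.subdiv hn

lemma PolyEnds.of_polynomial {n : ℕ} {J : ℤ} {p : Polynomial ℝ} (hp : p.degree < (n + 1 : ℕ)) :
    PolyEnds n J fun j => p.eval (j : ℝ) :=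
  ⟨⟨p, hp, fun _ _ => rfl⟩, p, hp, fun _ _ => rfl⟩

/-- In the interior both rules read the same nodes. Near a boundary the stencils differ, but both
lie where `u` is a polynomial of degree at most `n`, which each rule reproduces. -/
lemma sum_predWeight_mul {n J m : ℕ} (hn : Odd n) (hJ : n ≤ J) (hm : m ≤ 2 * J) {u : ℤ → ℝ}
    (hu : PolyEnds n J u) :
    ∑ j : Fin (J + 1), predWeight n J m j * u ((j : ℕ) : ℤ) = subdiv n u m := by
  rw [Fin.sum_univ_eq_sum_range (fun j => predWeight n J m j * u (j : ℤ))]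
  by_cases he : Even m
  · obtain ⟨p, rfl⟩ := he
    rw [Finset.sum_eq_single p]
    · have h1 : predWeight n J (p + p) p = 1 := by simp [predWeight, two_mul]
      have h2 := subdiv_two_mul n u p
      rw [h1, one_mul, ← h2, two_mul, Nat.cast_add]
    · intro b _ hb
      have : predWeight n J (p + p) b = 0 := by
        rw [predWeight, if_pos ⟨p, rfl⟩, if_neg (by omega)]
      rw [this, zero_mul]
    · intro h
      exact absurd (Finset.mem_range.2 (by omega)) h
  · set st := stencilStart n J (m / 2) with hst
    have hstJ : st ≤ J - n := min_le_right _ _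
    have hsum : ∑ j ∈ Finset.range (J + 1), predWeight n J m j * u (j : ℤ)
        = ∑ j ∈ Finset.Icc st (st + n), u (j : ℤ)
          * (Lagrange.basis (Finset.Icc st (st + n)) (fun i : ℕ => (i : ℝ)) j).eval ((m : ℝ) / 2)
        := by
      have hsub : Finset.Icc st (st + n) ⊆ Finset.range (J + 1) := fun j hj => by
        rw [Finset.mem_Icc] at hj
        rw [Finset.mem_range]
        omega
      rw [← Finset.sum_subset hsub]
      · refine Finset.sum_congr rfl fun j hj => ?_
        rw [predWeight, if_neg he, if_pos hj, mul_comm]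
      · intro j _ hj
        rw [predWeight, if_neg he, if_neg hj, zero_mul]
    have hcard : (Finset.Icc st (st + n)).card = n + 1 := by simp; omega
    -- Both sides equal `r (m / 2)` as soon as one polynomial `r` serves both stencils: an end
    -- polynomial of `u` near the boundary, the local interpolant otherwise.
    have key : ∀ r : Polynomial ℝ, r.degree < (n + 1 : ℕ) →
        (∀ j ∈ Finset.Icc st (st + n), u (j : ℤ) = r.eval (j : ℝ)) →
        subdiv n u m = r.eval ((m : ℝ) / 2) →
        ∑ j ∈ Finset.range (J + 1), predWeight n J m j * u (j : ℤ) = subdiv n u m := by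
      intro r hr h1 h2
      rw [hsum, h2, ← sum_eval_mul_basis (s := Finset.Icc st (st + n)) (by rw [hcard]; exact hr)]
      exact Finset.sum_congr rfl fun j hj => by rw [h1 j hj]
    obtain ⟨k, hk⟩ := hn
    obtain ⟨p, hp⟩ := Nat.not_even_iff_odd.1 he
    have hcast : (((m : ℕ) : ℤ) : ℝ) = (m : ℝ) := by norm_cast
    have hst' : st = min (p - k) (J - n) := by
      rw [hst, stencilStart]; congr 2 <;> omega
    by_cases hleft : p < k
    · obtain ⟨⟨r, hr, hru⟩, -⟩ := hu
      have hst0 : st = 0 := by omega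
      refine key r hr (fun j hj => ?_) ?_
      · rw [Finset.mem_Icc] at hj
        exact_mod_cast hru j (by omega)
      · rw [subdiv_eq_eval ⟨k, hk⟩ hr fun j hj => hru j (by rw [abs_le] at hj; omega), hcast]
    by_cases hright : J - n < p - k
    · obtain ⟨-, r, hr, hru⟩ := hu
      have hst0 : st = J - n := by omega
      refine key r hr (fun j hj => ?_) ?_
      · rw [Finset.mem_Icc] at hj
        exact_mod_cast hru j (by omega)
      · rw [subdiv_eq_eval ⟨k, hk⟩ hr fun j hj => hru j (by rw [abs_le] at hj; omega), hcast]
    have hst0 : st = p - k := by omega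
    have hinj : Set.InjOn (fun i : ℕ => (i : ℝ)) (Finset.Icc st (st + n) : Set ℕ) :=
      fun a _ b _ h => Nat.cast_injective h
    have hdeg := Lagrange.degree_interpolate_lt (fun j : ℕ => u (j : ℤ)) hinj
    rw [hcard] at hdeg
    have hval : ∀ j ∈ Finset.Icc st (st + n), u (j : ℤ) = (Lagrange.interpolate
        (Finset.Icc st (st + n)) (fun i : ℕ => (i : ℝ)) (fun j : ℕ => u (j : ℤ))).eval (j : ℝ) :=
      fun j hj => (Lagrange.eval_interpolate_at_node (fun j : ℕ => u (j : ℤ)) hinj hj).symm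
    refine key _ hdeg hval ?_
    rw [subdiv_eq_eval ⟨k, hk⟩ hdeg, hcast]
    intro j hj
    rw [abs_le] at hj
    have hj0 : 0 ≤ j := by omega
    lift j to ℕ using hj0
    have := hval j (by rw [Finset.mem_Icc]; omega)
    exact_mod_cast this

/-- Bound for the extrapolation of grid values by `n` nodes beyond the boundary. -/
noncomputable def extrapolationConst (n : ℕ) : ℝ :=
  1 + ∑ x ∈ Finset.Icc (-(n : ℤ)) (2 * n), ∑ s ∈ Finset.range (n + 1),
    |(Lagrange.basis (Finset.range (n + 1)) (fun i : ℕ => (i : ℝ)) s).eval (x : ℝ)|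

lemma one_le_extrapolationConst (n : ℕ) : 1 ≤ extrapolationConst n :=
  le_add_of_nonneg_right (Finset.sum_nonneg fun _ _ => Finset.sum_nonneg fun _ _ => abs_nonneg _)

lemma abs_eval_interpolate_le {n : ℕ} {r : ℕ → ℝ} {B : ℝ} (hr : ∀ s ≤ n, |r s| ≤ B) {x : ℤ}
    (hx : -(n : ℤ) ≤ x) (hx' : x ≤ 2 * n) :
    |(Lagrange.interpolate (Finset.range (n + 1)) (fun i : ℕ => (i : ℝ)) r).eval (x : ℝ)|
      ≤ extrapolationConst n * B := by
  have hB : 0 ≤ B := (abs_nonneg _).trans (hr 0 (Nat.zero_le _))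
  rw [Lagrange.interpolate_apply, Polynomial.eval_finsetSum]
  calc _ ≤ ∑ s ∈ Finset.range (n + 1), |(Polynomial.C (r s)
          * Lagrange.basis (Finset.range (n + 1)) (fun i : ℕ => (i : ℝ)) s).eval (x : ℝ)| :=
        Finset.abs_sum_le_sum_abs _ _
    _ ≤ ∑ s ∈ Finset.range (n + 1),
          |(Lagrange.basis (Finset.range (n + 1)) (fun i : ℕ => (i : ℝ)) s).eval (x : ℝ)| * B := by
        refine Finset.sum_le_sum fun s hs => ?_
        rw [Polynomial.eval_mul, Polynomial.eval_C, abs_mul, mul_comm]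
        exact mul_le_mul_of_nonneg_left (hr s (by have := Finset.mem_range.1 hs; omega))
          (abs_nonneg _)
    _ ≤ extrapolationConst n * B := by
        rw [← Finset.sum_mul]
        refine mul_le_mul_of_nonneg_right ?_ hB
        have := Finset.single_le_sum (f := fun x : ℤ => ∑ s ∈ Finset.range (n + 1),
          |(Lagrange.basis (Finset.range (n + 1)) (fun i : ℕ => (i : ℝ)) s).eval (x : ℝ)|)
          (fun _ _ => Finset.sum_nonneg fun _ _ => abs_nonneg _) (Finset.mem_Icc.2 ⟨hx, hx'⟩)
        rw [extrapolationConst]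
        linarith

lemma exists_extension {n J : ℕ} (hJ : n ≤ J) (z : Fin (J + 1) → ℝ) {B : ℝ}
    (hz : ∀ j, |z j| ≤ B) :
    ∃ u : ℤ → ℝ, PolyEnds n J u ∧ (∀ j : Fin (J + 1), u ((j : ℕ) : ℤ) = z j) ∧
      ∀ j : ℤ, -(n : ℤ) ≤ j → j ≤ J + n → |u j| ≤ extrapolationConst n * B := by
  have hB : 0 ≤ B := (abs_nonneg _).trans (hz 0)
  -- `Fin.ofNat` wraps around above `J`, but only indices up to `J` enter the construction.
  set v : ℕ → ℝ := fun j => z (Fin.ofNat (J + 1) j) with hv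
  have hvB : ∀ j, |v j| ≤ B := fun j => hz _
  have hinj : Set.InjOn (fun i : ℕ => (i : ℝ)) (Finset.range (n + 1) : Set ℕ) :=
    fun a _ b _ h => Nat.cast_injective h
  set p := Lagrange.interpolate (Finset.range (n + 1)) (fun i : ℕ => (i : ℝ)) v with hp
  set q₀ := Lagrange.interpolate (Finset.range (n + 1)) (fun i : ℕ => (i : ℝ))
    (fun s => v (J - n + s)) with hq₀
  -- The shift moves the last `n + 1` nodes to `0, …, n`, so one extrapolation constant serves both
  -- ends.
  set q := q₀.comp (Polynomial.X - Polynomial.C ((J : ℝ) - n)) with hq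
  have hpd : p.degree < (n + 1 : ℕ) := by
    simpa only [Finset.card_range] using Lagrange.degree_interpolate_lt v hinj
  have hqd : q.degree < (n + 1 : ℕ) :=
    degree_comp_lt (by simpa only [Finset.card_range] using
      Lagrange.degree_interpolate_lt (fun s => v (J - n + s)) hinj)
      (by rw [Polynomial.natDegree_X_sub_C])
  have hqe : ∀ j : ℤ, q.eval (j : ℝ) = q₀.eval ((j - (J - n) : ℤ) : ℝ) := fun j => by
    rw [hq, Polynomial.eval_comp]; simp
  refine ⟨fun j => if j < 0 then p.eval (j : ℝ) else if j ≤ J then v j.toNat else q.eval (j : ℝ),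
    ⟨⟨p, hpd, fun j hj => ?_⟩, q, hqd, fun j hj => ?_⟩, fun j => ?_, fun j hj hj' => ?_⟩
  · by_cases h0 : j < 0
    · simp [h0]
    · lift j to ℕ using not_lt.1 h0
      simp only [h0, if_false]
      rw [if_pos (by omega), Int.toNat_natCast, Int.cast_natCast]
      exact (Lagrange.eval_interpolate_at_node v hinj
        (i := j) (by rw [Finset.mem_range]; omega)).symm
  · have h0 : ¬ j < 0 := by omega
    simp only [h0, if_false]
    by_cases h1 : j ≤ J
    · rw [if_pos h1, hqe]
      obtain ⟨s, hs⟩ := Int.eq_ofNat_of_zero_le (sub_nonneg.2 hj)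
      have := Lagrange.eval_interpolate_at_node (fun s => v (J - n + s)) hinj
        (i := s) (by rw [Finset.mem_range]; omega)
      rw [hs, Int.cast_natCast, hq₀, this]
      congr 1
      omega
    · rw [if_neg h1]
  · have := j.is_lt
    simp only []
    rw [if_neg (by omega), if_pos (by omega), Int.toNat_natCast, hv]
    simp
  · simp only []
    split_ifs with h0 h1
    · exact abs_eval_interpolate_le (fun s _ => hvB s) hj (by omega)
    · exact (hvB _).trans (le_mul_of_one_le_left hB (one_le_extrapolationConst n))
    · rw [hqe]
      exact abs_eval_interpolate_le (fun s _ => hvB _) (by omega) (by omega)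

/-- Bound for the absolute row sums of the one-dimensional recursive prediction. -/
noncomputable def stabilityConst (n : ℕ) : ℝ := (2 * n + 1) * extrapolationConst n

lemma one_le_stabilityConst (n : ℕ) : 1 ≤ stabilityConst n := by
  have h1 := one_le_extrapolationConst n
  have h2 : (1 : ℝ) ≤ 2 * n + 1 := by
    have : (0 : ℝ) ≤ n := n.cast_nonneg
    linarith
  rw [stabilityConst]
  nlinarith

/-- Duality: the absolute sum of a row is its value on the sign pattern of its entries, which are
data bounded by one. -/
lemma sum_abs_le_of_eq_subdiv {n J m i : ℕ} (hn : Odd n) (hJ : n ≤ J) (hi : i ≤ 2 ^ m * J)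
    {w : Fin (J + 1) → ℝ}
    (hw : ∀ u : ℤ → ℝ, PolyEnds n J u →
      ∑ j : Fin (J + 1), w j * u ((j : ℕ) : ℤ) = (subdiv n)^[m] u i) :
    ∑ j, |w j| ≤ stabilityConst n := by
  obtain ⟨u, hu, huz, huB⟩ := exists_extension hJ (fun j => ((SignType.sign (w j) : SignType) : ℝ))
    (B := 1) (fun j => by rcases SignType.sign (w j) <;> simp)
  have h1 := hw u hu
  have h2 : ∑ j : Fin (J + 1), w j * u ((j : ℕ) : ℤ) = ∑ j, |w j| :=
    Finset.sum_congr rfl fun j _ => by rw [huz, mul_comm, sign_mul_self]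
  rw [← h2, h1]
  refine (le_abs_self _).trans ((abs_subdiv_iterate_le hn m (J := J) (by positivity)
    (by exact_mod_cast hi) huB).trans_eq ?_)
  rw [stabilityConst, mul_one]

lemma sum_abs_predWeight_le {n J m : ℕ} (hn : Odd n) (hJ : n ≤ J) (hm : m ≤ 2 * J) :
    ∑ j : Fin (J + 1), |predWeight n J m j| ≤ stabilityConst n :=
  sum_abs_le_of_eq_subdiv hn hJ (m := 1) (i := m) (by simpa using hm) fun _ hu =>
    sum_predWeight_mul hn hJ hm hu

/-- Exactness on `(2 x - m) ^ r`, evaluated at its zero `x = m / 2`. These moment conditions carry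
the consistency estimate. -/
lemma sum_predWeight_mul_pow {n J m r : ℕ} (hn : Odd n) (hJ : n ≤ J) (hm : m ≤ 2 * J)
    (hr : r ≤ n) :
    ∑ j : Fin (J + 1), predWeight n J m j * (2 * ((j : ℕ) : ℝ) - m) ^ r = 0 ^ r := by
  set p : Polynomial ℝ := (Polynomial.X ^ r).comp
    (Polynomial.C 2 * Polynomial.X + Polynomial.C (-(m : ℝ))) with hp
  have hpd : p.degree < (n + 1 : ℕ) := by
    refine degree_comp_lt ?_ Polynomial.natDegree_linear_le
    rw [Polynomial.degree_X_pow]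
    exact_mod_cast Nat.lt_succ_of_le hr
  have h := sum_predWeight_mul hn hJ hm (PolyEnds.of_polynomial (J := J) hpd)
  rw [subdiv_eq_eval hn hpd fun _ _ => rfl] at h
  simp only [hp, Polynomial.eval_comp, Polynomial.eval_pow, Polynomial.eval_X,
    Polynomial.eval_add, Polynomial.eval_mul, Polynomial.eval_C, Int.cast_natCast] at h
  rw [show 2 * ((m : ℝ) / 2) + -(m : ℝ) = 0 by ring] at h
  simpa only [sub_eq_add_neg] using h

lemma abs_sub_le_of_predWeight_ne_zero {n J m j : ℕ} (hn : Odd n) (hJ : n ≤ J) (hm : m ≤ 2 * J)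
    (h : predWeight n J m j ≠ 0) : |2 * (j : ℝ) - m| ≤ 2 * n := by
  suffices h : |2 * (j : ℤ) - m| ≤ 2 * n by exact_mod_cast h
  rw [abs_le]
  rw [predWeight] at h
  split_ifs at h with h1 h2 h3
  · omega
  · exact absurd rfl h
  · rw [Finset.mem_Icc, stencilStart] at h3
    obtain ⟨k, hk⟩ := hn
    omega
  · exact absurd rfl h

/-! ### Tensor products and the recursive prediction -/

lemma cells_succ (J₀ k : ℕ) : cells J₀ (k + 1) = 2 * cells J₀ k := by
  simp only [cells, pow_succ]; ring

lemma cells_eq_two_pow_mul (J₀ : ℕ) {ℓ k : ℕ} (h : ℓ ≤ k) :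
    cells J₀ k = 2 ^ (k - ℓ) * cells J₀ ℓ := by
  obtain ⟨m, rfl⟩ := Nat.exists_eq_add_of_le h
  simp only [cells, pow_add, Nat.add_sub_cancel_left]; ring

lemma le_cells {n J₀ : ℕ} (hJ₀ : n ≤ J₀) (k : ℕ) : n ≤ cells J₀ k :=
  hJ₀.trans (Nat.le_mul_of_pos_right _ (by positivity))

lemma pred_self (d n J₀ ℓ : ℕ) : pred d n J₀ (le_refl ℓ) = LinearMap.id :=
  Nat.leRecOn_self _

lemma pred_succ (d n J₀ : ℕ) {ℓ k : ℕ} (h : ℓ ≤ k) (h' : ℓ ≤ k + 1) :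
    pred d n J₀ h' = (predStep d n J₀ k).comp (pred d n J₀ h) :=
  Nat.leRecOn_succ h _

lemma pred_comp (d n J₀ : ℕ) {ℓ m k : ℕ} (h₁ : ℓ ≤ m) (h₂ : m ≤ k) (h : ℓ ≤ k) :
    pred d n J₀ h = (pred d n J₀ h₂).comp (pred d n J₀ h₁) := by
  induction k, h₂ using Nat.le_induction with
  | base => rw [pred_self, LinearMap.id_comp]
  | succ k hk ih => rw [pred_succ d n J₀ (h₁.trans hk), pred_succ d n J₀ hk,
      ih (h₁.trans hk), LinearMap.comp_assoc]

lemma pred_one_step (d n J₀ k : ℕ) (h : k ≤ k + 1) : pred d n J₀ h = predStep d n J₀ k := by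
  rw [pred_succ d n J₀ le_rfl, pred_self, LinearMap.comp_id]

/-- The tensor power of a matrix, as a linear map between grid functions. -/
noncomputable def tensorMap (d : ℕ) {I J : ℕ} (W : Matrix (Fin (I + 1)) (Fin (J + 1)) ℝ) :
    GridFn d J →ₗ[ℝ] GridFn d I :=
  Matrix.mulVecLin (Matrix.of fun i j => ∏ a, W (i a) (j a))

lemma tensorMap_apply (d : ℕ) {I J : ℕ} (W : Matrix (Fin (I + 1)) (Fin (J + 1)) ℝ)
    (z : GridFn d J) (i : Fin d → Fin (I + 1)) :
    tensorMap d W z i = ∑ j : Fin d → Fin (J + 1), (∏ a, W (i a) (j a)) * z j := rfl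

lemma sum_prod_eq_prod_sum {d J : ℕ} (f : Fin d → Fin (J + 1) → ℝ) :
    ∑ j : Fin d → Fin (J + 1), ∏ a, f a (j a) = ∏ a, ∑ j, f a j := by
  rw [Finset.prod_univ_sum, Fintype.piFinset_univ]

lemma tensorMap_comp (d : ℕ) {I J K : ℕ} (V : Matrix (Fin (I + 1)) (Fin (J + 1)) ℝ)
    (W : Matrix (Fin (J + 1)) (Fin (K + 1)) ℝ) :
    (tensorMap d V).comp (tensorMap d W) = tensorMap d (V * W) := by
  rw [tensorMap, tensorMap, ← Matrix.mulVecLin_mul, tensorMap]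
  congr 1
  ext i j
  simp only [Matrix.mul_apply, Matrix.of_apply, ← Finset.prod_mul_distrib]
  exact sum_prod_eq_prod_sum fun a t => V (i a) t * W t (j a)

lemma tensorMap_one (d J : ℕ) :
    tensorMap d (1 : Matrix (Fin (J + 1)) (Fin (J + 1)) ℝ) = LinearMap.id := by
  rw [← Matrix.mulVecLin_one, tensorMap]
  congr 1
  ext i j
  simp only [Matrix.of_apply, Matrix.one_apply]
  by_cases h : i = j
  · simp [h]
  · obtain ⟨a, ha⟩ := Function.ne_iff.1 h
    rw [if_neg h]
    exact Finset.prod_eq_zero (Finset.mem_univ a) (if_neg ha)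

lemma norm_tensorMap_le {d I J : ℕ} {W : Matrix (Fin (I + 1)) (Fin (J + 1)) ℝ} {Λ : ℝ}
    (hW : ∀ i, ∑ j, |W i j| ≤ Λ) (z : GridFn d J) :
    ‖tensorMap d W z‖ ≤ Λ ^ d * ‖z‖ := by
  have hΛ : 0 ≤ Λ := (Finset.sum_nonneg fun _ _ => abs_nonneg _).trans (hW 0)
  refine (pi_norm_le_iff_of_nonneg (by positivity)).2 fun i => ?_
  rw [tensorMap_apply, Real.norm_eq_abs]
  calc _ ≤ ∑ j : Fin d → Fin (J + 1), |(∏ a, W (i a) (j a)) * z j| :=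
        Finset.abs_sum_le_sum_abs _ _
    _ ≤ ∑ j : Fin d → Fin (J + 1), (∏ a, |W (i a) (j a)|) * ‖z‖ := by
        refine Finset.sum_le_sum fun j _ => ?_
        rw [abs_mul, Finset.abs_prod]
        exact mul_le_mul_of_nonneg_left (norm_le_pi_norm z j)
          (Finset.prod_nonneg fun _ _ => abs_nonneg _)
    _ ≤ Λ ^ d * ‖z‖ := by
        rw [← Finset.sum_mul, sum_prod_eq_prod_sum fun a t => |W (i a) t|]
        refine mul_le_mul_of_nonneg_right ?_ (norm_nonneg _)
        refine (Finset.prod_le_prod (fun a _ => Finset.sum_nonneg fun _ _ => abs_nonneg _)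
          fun a _ => hW (i a)).trans_eq ?_
        simp

/-- The one-dimensional prediction matrix. -/
noncomputable def predMatrix (n J₀ k : ℕ) :
    Matrix (Fin (cells J₀ (k + 1) + 1)) (Fin (cells J₀ k + 1)) ℝ :=
  Matrix.of fun i j => predWeight n (cells J₀ k) i j

lemma predStep_eq_tensorMap (d n J₀ k : ℕ) :
    predStep d n J₀ k = tensorMap d (predMatrix n J₀ k) := rfl

/-- Composition commutes with tensor powers, so stability is a one-dimensional matter. The induction
closes because the polynomial ends survive subdivision. -/
lemma exists_pred_eq_tensorMap (d : ℕ) {n J₀ : ℕ} (hn : Odd n) (hJ₀ : n ≤ J₀) {ℓ k : ℕ}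
    (h : ℓ ≤ k) :
    ∃ W : Matrix (Fin (cells J₀ k + 1)) (Fin (cells J₀ ℓ + 1)) ℝ,
      pred d n J₀ h = tensorMap d W ∧
      ∀ u : ℤ → ℝ, PolyEnds n (cells J₀ ℓ) u → ∀ i : Fin (cells J₀ k + 1),
        ∑ j, W i j * u ((j : ℕ) : ℤ) = (subdiv n)^[k - ℓ] u ((i : ℕ) : ℤ) := by
  induction k, h using Nat.le_induction with
  | base =>
    refine ⟨1, by rw [pred_self, tensorMap_one], fun u _ i => ?_⟩
    simp [Matrix.one_apply]
  | succ k hk ih =>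
    obtain ⟨W, hW, hWu⟩ := ih
    refine ⟨predMatrix n J₀ k * W, ?_, fun u hu i => ?_⟩
    · rw [pred_succ d n J₀ hk, hW, predStep_eq_tensorMap, tensorMap_comp]
    · rw [Nat.succ_sub hk, Function.iterate_succ_apply']
      have hi : (i : ℕ) ≤ 2 * cells J₀ k := by
        have h1 := i.is_lt
        have h2 := cells_succ J₀ k
        omega
      have hends : PolyEnds n (cells J₀ k) ((subdiv n)^[k - ℓ] u) := by
        rw [cells_eq_two_pow_mul J₀ hk]
        push_cast
        exact hu.subdiv_iterate hn _
      rw [← sum_predWeight_mul hn (le_cells hJ₀ k) hi hends]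
      simp only [← hWu u hu, Matrix.mul_apply, Finset.sum_mul, Finset.mul_sum]
      rw [Finset.sum_comm]
      refine Finset.sum_congr rfl fun t _ => Finset.sum_congr rfl fun j _ => ?_
      rw [mul_assoc]
      rfl

/-- The recursive prediction operators are uniformly bounded. -/
lemma norm_pred_le {d n J₀ : ℕ} (hn : Odd n) (hJ₀ : n ≤ J₀) {ℓ k : ℕ} (h : ℓ ≤ k)
    (z : GridFn d (cells J₀ ℓ)) :
    ‖pred d n J₀ h z‖ ≤ stabilityConst n ^ d * ‖z‖ := by
  obtain ⟨W, hW, hWu⟩ := exists_pred_eq_tensorMap d hn hJ₀ h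
  rw [hW]
  refine norm_tensorMap_le (fun i => ?_) z
  refine sum_abs_le_of_eq_subdiv hn (le_cells hJ₀ ℓ) (m := k - ℓ) (i := i) ?_
    fun u hu => hWu u hu i
  rw [← cells_eq_two_pow_mul J₀ h]
  have := i.is_lt
  omega

/-- Coarse values reappear at the even fine nodes. The bound gives injectivity and coercivity at
every level, and the estimate of the corrections. -/
lemma norm_le_norm_predStep {d n J₀ k : ℕ} (z : GridFn d (cells J₀ k)) :
    ‖z‖ ≤ ‖predStep d n J₀ k z‖ := by
  refine (pi_norm_le_iff_of_nonneg (norm_nonneg _)).2 fun i => ?_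
  have hlt : ∀ a, 2 * (i a : ℕ) < cells J₀ (k + 1) + 1 := fun a => by
    have := (i a).is_lt
    rw [cells_succ]
    omega
  have hw : ∀ (a : Fin d) (t : Fin (cells J₀ k + 1)),
      predMatrix n J₀ k ⟨2 * (i a : ℕ), hlt a⟩ t = if t = i a then 1 else 0 := fun a t => by
    simp [predMatrix, predWeight, Fin.ext_iff]
  have h : predStep d n J₀ k z (fun a => ⟨2 * (i a : ℕ), hlt a⟩) = z i := by
    rw [predStep_eq_tensorMap, tensorMap_apply, Finset.sum_eq_single i]
    · simp [hw]
    · intro j _ hj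
      obtain ⟨a, ha⟩ := Function.ne_iff.1 hj
      rw [Finset.prod_eq_zero (Finset.mem_univ a) (by rw [hw, if_neg ha]), zero_mul]
    · intro h
      exact absurd (Finset.mem_univ _) h
  rw [← h]
  exact norm_le_pi_norm (predStep d n J₀ k z) _

lemma norm_le_norm_pred {d n J₀ ℓ k : ℕ} (h : ℓ ≤ k) (z : GridFn d (cells J₀ ℓ)) :
    ‖z‖ ≤ ‖pred d n J₀ h z‖ := by
  induction k, h using Nat.le_induction with
  | base => rw [pred_self]; rfl
  | succ k hk ih =>
    rw [pred_succ d n J₀ hk]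
    exact ih.trans (norm_le_norm_predStep _)

/-! ### Consistency -/

lemma hasDerivAt_taylor_sum (c : ℕ → ℝ) (N : ℕ) (t : ℝ) :
    HasDerivAt (fun t : ℝ => ∑ k ∈ Finset.range (N + 1), c k * (t ^ k / k.factorial))
      (∑ k ∈ Finset.range N, c (k + 1) * (t ^ k / k.factorial)) t := by
  simp only [Finset.sum_range_succ' _ N]
  have h : HasDerivAt (fun t : ℝ => ∑ k ∈ Finset.range N,
      c (k + 1) * (t ^ (k + 1) / (k + 1).factorial))
      (∑ k ∈ Finset.range N, c (k + 1) * (t ^ k / k.factorial)) t := by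
    refine HasDerivAt.fun_sum fun k _ => HasDerivAt.const_mul _ ?_
    have h1 := (hasDerivAt_pow (k + 1) t).div_const ((k + 1).factorial : ℝ)
    convert h1 using 1
    rw [Nat.factorial_succ, Nat.add_sub_cancel]
    have h2 : (k.factorial : ℝ) ≠ 0 := by positivity
    have h3 : (k : ℝ) + 1 ≠ 0 := by positivity
    push_cast
    field_simp
  exact (h.add_const (c 0 * (t ^ 0 / (0 : ℕ).factorial))).congr_deriv rfl

/-- A crude form of the Taylor estimate on the unit interval. -/
lemma abs_sub_taylor_sum_le {N : ℕ} {φ : ℕ → ℝ → ℝ} {M : ℝ}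
    (hφ : ∀ k < N, ∀ t ∈ Icc (0 : ℝ) 1, HasDerivWithinAt (φ k) (φ (k + 1) t) (Icc 0 1) t)
    (hM : ∀ t ∈ Icc (0 : ℝ) 1, |φ N t| ≤ M) {t : ℝ} (ht : t ∈ Icc (0 : ℝ) 1) :
    |φ 0 t - ∑ k ∈ Finset.range N, φ k 0 * (t ^ k / k.factorial)| ≤ M := by
  induction N generalizing φ t with
  | zero => simpa using hM t ht
  | succ N ih =>
    have hd : ∀ t ∈ Icc (0 : ℝ) 1, HasDerivWithinAt
        (fun t => φ 0 t - ∑ k ∈ Finset.range (N + 1), φ k 0 * (t ^ k / k.factorial))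
        (φ 1 t - ∑ k ∈ Finset.range N, φ (k + 1) 0 * (t ^ k / k.factorial)) (Icc 0 1) t :=
      fun t ht => (hφ 0 (Nat.succ_pos N) t ht).sub
        (hasDerivAt_taylor_sum (fun k => φ k 0) N t).hasDerivWithinAt
    have hb : ∀ t ∈ Icc (0 : ℝ) 1,
        ‖φ 1 t - ∑ k ∈ Finset.range N, φ (k + 1) 0 * (t ^ k / k.factorial)‖ ≤ M := fun t ht =>
      ih (φ := fun k => φ (k + 1)) (fun k hk => hφ (k + 1) (by omega)) hM ht
    have h := (convex_Icc (0 : ℝ) 1).norm_image_sub_le_of_norm_hasDerivWithin_le hd hb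
      (left_mem_Icc.2 zero_le_one) ht
    have h0 : ∑ k ∈ Finset.range (N + 1), φ k 0 * ((0 : ℝ) ^ k / k.factorial) = φ 0 0 := by
      rw [Finset.sum_range_succ']
      simp
    rw [h0, sub_self, sub_zero, sub_zero, Real.norm_eq_abs, Real.norm_eq_abs,
      abs_of_nonneg ht.1] at h
    exact h.trans (mul_le_of_le_one_right ((norm_nonneg _).trans (hb 0 (by simp))) ht.2)

lemma uniqueDiffOn_cube (d : ℕ) : UniqueDiffOn ℝ (Icc (0 : Fin d → ℝ) 1) := by
  rw [← Set.pi_univ_Icc]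
  exact UniqueDiffOn.univ_pi fun _ => uniqueDiffOn_Icc zero_lt_one

/-- One-dimensional Taylor along the segment from `x` to `y`, which stays in the convex cube; `M`
bounds the `N`-th derivative on this compact set. -/
lemma exists_taylor_bound {d N : ℕ} {f : (Fin d → ℝ) → ℝ}
    (hf : ContDiffOn ℝ (N : ℕ) f (Icc 0 1)) :
    ∃ M : ℝ, 0 ≤ M ∧ ∀ x ∈ Icc (0 : Fin d → ℝ) 1, ∀ y ∈ Icc (0 : Fin d → ℝ) 1,
      |f y - ∑ k ∈ Finset.range N,
        iteratedFDerivWithin ℝ k f (Icc 0 1) x (fun _ => y - x) * (1 / k.factorial)|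
        ≤ M * ‖y - x‖ ^ N := by
  have hK := uniqueDiffOn_cube d
  obtain ⟨M, hM⟩ := isCompact_Icc.exists_bound_of_continuousOn
    (hf.continuousOn_iteratedFDerivWithin le_rfl hK)
  refine ⟨M, (norm_nonneg _).trans (hM 0 (by simp)), fun x hx y hy => ?_⟩
  set v := y - x with hv
  have hmaps : ∀ t ∈ Icc (0 : ℝ) 1, x + t • v ∈ Icc (0 : Fin d → ℝ) 1 := fun t ht =>
    (convex_Icc (0 : Fin d → ℝ) 1).add_smul_sub_mem hx hy ht
  set φ : ℕ → ℝ → ℝ := fun k t =>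
    iteratedFDerivWithin ℝ k f (Icc 0 1) (x + t • v) (fun _ => v) with hφ
  have hder : ∀ k < N, ∀ t ∈ Icc (0 : ℝ) 1,
      HasDerivWithinAt (φ k) (φ (k + 1) t) (Icc 0 1) t := by
    intro k hk t ht
    have h1 := (hf.ftaylorSeriesWithin hK).fderivWithin k (by exact_mod_cast hk) _ (hmaps t ht)
    have hline : HasDerivWithinAt (fun t : ℝ => x + t • v) v (Icc 0 1) t := by
      have := ((hasDerivAt_id t).smul_const v).const_add x
      simpa using this.hasDerivWithinAt
    have h2 := h1.comp_hasDerivWithinAt t hline hmaps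
    have h3 := (ContinuousMultilinearMap.apply ℝ (fun _ : Fin k => Fin d → ℝ) ℝ
      (fun _ => v)).hasFDerivAt.comp_hasDerivWithinAt t h2
    refine h3.congr_deriv ?_
    change iteratedFDerivWithin ℝ (k + 1) f (Icc 0 1) (x + t • v) (Fin.cons v fun _ => v)
      = iteratedFDerivWithin ℝ (k + 1) f (Icc 0 1) (x + t • v) fun _ => v
    congr 1
    ext i
    refine Fin.cases ?_ (fun _ => ?_) i <;> simp
  have hbound : ∀ t ∈ Icc (0 : ℝ) 1, |φ N t| ≤ M * ‖v‖ ^ N := fun t ht => by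
    refine ((iteratedFDerivWithin ℝ N f (Icc 0 1) (x + t • v)).le_opNorm _).trans ?_
    rw [Finset.prod_const, Finset.card_univ, Fintype.card_fin]
    exact mul_le_mul_of_nonneg_right (hM _ (hmaps t ht)) (by positivity)
  have h := abs_sub_taylor_sum_le hder hbound (right_mem_Icc.2 zero_le_one)
  simpa [hφ, hv] using h

/-- Expanding `A` in coordinates gives monomials whose weighted sums factor into one-dimensional
moments of order at most `k`. If `k > 0`, some exponent is positive and that factor vanishes. -/
lemma sum_prod_mul_multilinear {d J n k : ℕ} (hk : k ≤ n) {w y : Fin d → Fin (J + 1) → ℝ}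
    (hw : ∀ a, ∀ r ≤ n, ∑ j, w a j * y a j ^ r = 0 ^ r)
    (A : ContinuousMultilinearMap ℝ (fun _ : Fin k => Fin d → ℝ) ℝ) :
    ∑ j : Fin d → Fin (J + 1), (∏ a, w a (j a)) * A (fun _ a => y a (j a))
      = if k = 0 then A 0 else 0 := by
  have hexp : ∀ v : Fin d → ℝ, A (fun _ => v)
      = ∑ r : Fin k → Fin d, (∏ i, v (r i)) * A (fun i => Pi.single (r i) 1) := fun v => by
    have h1 : (fun _ : Fin k => v)
        = fun _ : Fin k => ∑ a, v a • (Pi.single a (1 : ℝ) : Fin d → ℝ) := by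
      funext _
      ext b
      simp [Pi.single_apply]
    rw [h1, A.map_sum]
    exact Finset.sum_congr rfl fun r _ => A.map_smul_univ _ _
  have hmon : ∀ r : Fin k → Fin d,
      ∑ j : Fin d → Fin (J + 1), (∏ a, w a (j a)) * ∏ i, y (r i) (j (r i))
        = ∏ a, (0 : ℝ) ^ (Finset.univ.filter fun i => r i = a).card := fun r => by
    have h1 : ∀ j : Fin d → Fin (J + 1), (∏ a, w a (j a)) * ∏ i, y (r i) (j (r i))
        = ∏ a, w a (j a) * y a (j a) ^ (Finset.univ.filter fun i => r i = a).card := fun j => by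
      rw [← Finset.prod_fiberwise' Finset.univ r fun a => y a (j a), ← Finset.prod_mul_distrib]
      exact Finset.prod_congr rfl fun a _ => by rw [Finset.prod_const]
    simp only [h1]
    rw [sum_prod_eq_prod_sum fun a t =>
      w a t * y a t ^ (Finset.univ.filter fun i => r i = a).card]
    refine Finset.prod_congr rfl fun a _ => hw a _ (le_trans ?_ hk)
    exact (Finset.card_le_univ _).trans_eq (Fintype.card_fin k)
  simp only [hexp, Finset.mul_sum]
  rw [Finset.sum_comm]
  simp only [← mul_assoc, ← Finset.sum_mul, hmon]
  split_ifs with h0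
  · subst h0
    rw [Fintype.sum_unique]
    simp
    congr 1
    ext i
    exact i.elim0
  · refine Finset.sum_eq_zero fun r _ => ?_
    have i : Fin k := ⟨0, Nat.pos_of_ne_zero h0⟩
    rw [Finset.prod_eq_zero (Finset.mem_univ (r i)), zero_mul]
    exact zero_pow (Finset.card_ne_zero_of_mem (Finset.mem_filter.2 ⟨Finset.mem_univ i, rfl⟩))

lemma cells_pos {J₀ : ℕ} (hJ₀ : 0 < J₀) (k : ℕ) : 0 < cells J₀ k :=
  Nat.mul_pos hJ₀ (by positivity)

lemma mesh_pos {J₀ : ℕ} (hJ₀ : 0 < J₀) (k : ℕ) : 0 < mesh J₀ k :=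
  one_div_pos.2 (by exact_mod_cast cells_pos hJ₀ k)

lemma mesh_eq_two_mul (J₀ k : ℕ) : mesh J₀ k = 2 * mesh J₀ (k + 1) := by
  rw [mesh, mesh, cells_succ]
  push_cast
  simp only [one_div, mul_inv]
  ring

lemma node_mem_cube {d J₀ k : ℕ} (hJ₀ : 0 < J₀) (i : Fin d → Fin (cells J₀ k + 1)) :
    (fun a => ((i a : ℕ) : ℝ) * mesh J₀ k) ∈ Icc (0 : Fin d → ℝ) 1 := by
  have h := mesh_pos hJ₀ k
  have hc : (0 : ℝ) < cells J₀ k := by exact_mod_cast cells_pos hJ₀ k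
  refine ⟨fun a => by simp only [Pi.zero_apply]; positivity, fun a => ?_⟩
  simp only [Pi.one_apply]
  rw [mesh, mul_one_div, div_le_one hc]
  exact_mod_cast Nat.lt_succ_iff.1 (i a).is_lt

/-- One prediction step reproduces smooth functions up to `O(h ^ (n + 1))`. -/
lemma exists_norm_predStep_sample_sub_le {d n J₀ : ℕ} (hn : Odd n) (hJ₀ : n ≤ J₀)
    {f : (Fin d → ℝ) → ℝ} (hf : ContDiffOn ℝ (n + 1 : ℕ) f (Icc 0 1)) :
    ∃ E : ℝ, 0 ≤ E ∧ ∀ k, ‖predStep d n J₀ k (sample J₀ k f) - sample J₀ (k + 1) f‖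
      ≤ E * mesh J₀ k ^ (n + 1) := by
  obtain ⟨M, hM0, hM⟩ := exists_taylor_bound hf
  have hΛ : 0 ≤ stabilityConst n := zero_le_one.trans (one_le_stabilityConst n)
  have hJpos : 0 < J₀ := hn.pos.trans_le hJ₀
  refine ⟨stabilityConst n ^ d * (M * (n : ℝ) ^ (n + 1)), by positivity, fun k => ?_⟩
  have hh := mesh_pos hJpos k
  refine (pi_norm_le_iff_of_nonneg (by positivity)).2 fun i => ?_
  have hi : ∀ a, (i a : ℕ) ≤ 2 * cells J₀ k := fun a => by
    have h1 := (i a).is_lt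
    have h2 := cells_succ J₀ k
    omega
  set x : Fin d → ℝ := fun a => ((i a : ℕ) : ℝ) * mesh J₀ (k + 1) with hx
  have hxK : x ∈ Icc (0 : Fin d → ℝ) 1 := node_mem_cube hJpos i
  set y : (Fin d → Fin (cells J₀ k + 1)) → Fin d → ℝ :=
    fun j a => ((j a : ℕ) : ℝ) * mesh J₀ k with hy
  have hyK : ∀ j, y j ∈ Icc (0 : Fin d → ℝ) 1 := fun j => node_mem_cube hJpos j
  set w : Fin d → Fin (cells J₀ k + 1) → ℝ := fun a t => predMatrix n J₀ k (i a) t with hw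
  have hdiff : ∀ (a : Fin d) (t : Fin (cells J₀ k + 1)),
      ((t : ℕ) : ℝ) * mesh J₀ k - x a = (2 * ((t : ℕ) : ℝ) - (i a : ℕ)) * mesh J₀ (k + 1) :=
    fun a t => by rw [mesh_eq_two_mul, hx]; ring
  have hmom : ∀ a, ∀ r ≤ n, ∑ t, w a t * (((t : ℕ) : ℝ) * mesh J₀ k - x a) ^ r = 0 ^ r := by
    intro a r hr
    have h1 := sum_predWeight_mul_pow hn (le_cells hJ₀ k) (hi a) hr
    have h2 : ∀ t, w a t * (((t : ℕ) : ℝ) * mesh J₀ k - x a) ^ r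
        = (predWeight n (cells J₀ k) (i a) t * (2 * ((t : ℕ) : ℝ) - (i a : ℕ)) ^ r)
          * mesh J₀ (k + 1) ^ r := fun t => by
      rw [hdiff, mul_pow, ← mul_assoc]; rfl
    simp only [h2]
    rw [← Finset.sum_mul, h1, ← mul_pow, zero_mul]
  -- Prediction applied to the Taylor polynomial about the fine node `x` leaves only the constant
  -- term.
  have hT : ∑ j : Fin d → Fin (cells J₀ k + 1), (∏ a, w a (j a)) * ∑ r ∈ Finset.range (n + 1),
      iteratedFDerivWithin ℝ r f (Icc 0 1) x (fun _ => y j - x) * (1 / r.factorial) = f x := by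
    simp only [Finset.mul_sum]
    rw [Finset.sum_comm, Finset.sum_range_succ', Finset.sum_eq_zero, zero_add]
    · simp only [← mul_assoc, ← Finset.sum_mul]
      have := sum_prod_mul_multilinear (Nat.zero_le n) hmom
        (iteratedFDerivWithin ℝ 0 f (Icc 0 1) x)
      rw [if_pos rfl, iteratedFDerivWithin_zero_apply] at this
      refine (congrArg (· * (1 / ((0 : ℕ).factorial : ℝ))) this).trans ?_
      simp
    · intro r hr
      simp only [← mul_assoc, ← Finset.sum_mul]
      have := sum_prod_mul_multilinear (Nat.succ_le_of_lt (Finset.mem_range.1 hr)) hmom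
        (iteratedFDerivWithin ℝ (r + 1) f (Icc 0 1) x)
      rw [if_neg (Nat.succ_ne_zero r)] at this
      refine (congrArg (· * (1 / ((r + 1).factorial : ℝ))) this).trans ?_
      simp
  have hE : (predStep d n J₀ k (sample J₀ k f) - sample J₀ (k + 1) f) i
      = ∑ j : Fin d → Fin (cells J₀ k + 1), (∏ a, w a (j a)) * (f (y j)
        - ∑ r ∈ Finset.range (n + 1),
          iteratedFDerivWithin ℝ r f (Icc 0 1) x (fun _ => y j - x) * (1 / r.factorial)) := by
    simp only [mul_sub, Finset.sum_sub_distrib]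
    rw [hT, Pi.sub_apply, predStep_eq_tensorMap, tensorMap_apply]
    rfl
  rw [hE, Real.norm_eq_abs]
  calc _ ≤ ∑ j : Fin d → Fin (cells J₀ k + 1), |(∏ a, w a (j a)) * (f (y j)
        - ∑ r ∈ Finset.range (n + 1),
          iteratedFDerivWithin ℝ r f (Icc 0 1) x (fun _ => y j - x) * (1 / r.factorial))| :=
        Finset.abs_sum_le_sum_abs _ _
    _ ≤ ∑ j : Fin d → Fin (cells J₀ k + 1),
          (∏ a, |w a (j a)|) * (M * (n * mesh J₀ k) ^ (n + 1)) := by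
        refine Finset.sum_le_sum fun j _ => ?_
        rw [abs_mul, Finset.abs_prod]
        -- Off the stencil the weight vanishes; on it the distance to `x` is at most `2 n h_{k+1} =
        -- n h_k` in each coordinate.
        by_cases hz : ∏ a, |w a (j a)| = 0
        · rw [hz, zero_mul, zero_mul]
        refine mul_le_mul_of_nonneg_left ?_ (Finset.prod_nonneg fun _ _ => abs_nonneg _)
        refine (hM x hxK (y j) (hyK j)).trans (mul_le_mul_of_nonneg_left ?_ hM0)
        refine pow_le_pow_left₀ (norm_nonneg _) ?_ _
        refine (pi_norm_le_iff_of_nonneg (by positivity)).2 fun a => ?_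
        have ha : predWeight n (cells J₀ k) (i a) (j a) ≠ 0 := fun h0 =>
          hz (Finset.prod_eq_zero (Finset.mem_univ a) (by
            rw [abs_eq_zero]; exact h0))
        have h1 := abs_sub_le_of_predWeight_ne_zero hn (le_cells hJ₀ k) (hi a) ha
        have h2 := mesh_pos hJpos (k + 1)
        rw [Pi.sub_apply, hdiff, Real.norm_eq_abs, abs_mul, abs_of_pos h2, mesh_eq_two_mul J₀ k]
        nlinarith
    _ ≤ stabilityConst n ^ d * (M * (n * mesh J₀ k) ^ (n + 1)) := by
        rw [← Finset.sum_mul, sum_prod_eq_prod_sum fun a t => |w a t|]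
        refine mul_le_mul_of_nonneg_right ?_ (by positivity)
        refine (Finset.prod_le_prod (fun a _ => Finset.sum_nonneg fun _ _ => abs_nonneg _)
          fun a _ => sum_abs_predWeight_le hn (le_cells hJ₀ k) (hi a)).trans_eq ?_
        simp
    _ = stabilityConst n ^ d * (M * (n : ℝ) ^ (n + 1)) * mesh J₀ k ^ (n + 1) := by
        rw [mul_pow]; ring

/-- The recursive prediction reproduces smooth functions up to `O(h_ℓ ^ (n + 1))`. -/
lemma exists_norm_pred_sample_sub_le {d n J₀ : ℕ} (hn : Odd n) (hJ₀ : n ≤ J₀)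
    {f : (Fin d → ℝ) → ℝ} (hf : ContDiffOn ℝ (n + 1 : ℕ) f (Icc 0 1)) :
    ∃ E : ℝ, 0 ≤ E ∧ ∀ (ℓ L : ℕ) (h : ℓ ≤ L),
      ‖pred d n J₀ h (sample J₀ ℓ f) - sample J₀ L f‖ ≤ E * mesh J₀ ℓ ^ (n + 1) := by
  obtain ⟨E, hE0, hE⟩ := exists_norm_predStep_sample_sub_le hn hJ₀ hf
  have hΛ : 0 ≤ stabilityConst n := zero_le_one.trans (one_le_stabilityConst n)
  have hJpos : 0 < J₀ := hn.pos.trans_le hJ₀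
  refine ⟨2 * (stabilityConst n ^ d * E), by positivity, fun ℓ L h => ?_⟩
  -- Splitting off the coarsest step leaves one consistency error, transported by the stable
  -- `P_{ℓ+1}^L`. The factor `2` closes the geometric sum, as `2 h_{ℓ+1}^(n+1) ≤ h_ℓ^(n+1)`.
  induction h using Nat.decreasingInduction with
  | self =>
    rw [pred_self, LinearMap.id_apply, sub_self, norm_zero]
    have := mesh_pos hJpos L
    positivity
  | of_succ ℓ hlt ih =>
    have hℓ : ℓ + 1 ≤ L := hlt
    have h1 : ℓ ≤ ℓ + 1 := Nat.le_succ ℓ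
    have hstep := norm_pred_le hn hJ₀ hℓ (predStep d n J₀ ℓ (sample J₀ ℓ f) - sample J₀ (ℓ + 1) f)
    have hsplit : pred d n J₀ (Nat.le_of_succ_le hℓ) (sample J₀ ℓ f) - sample J₀ L f
        = pred d n J₀ hℓ (predStep d n J₀ ℓ (sample J₀ ℓ f) - sample J₀ (ℓ + 1) f)
          + (pred d n J₀ hℓ (sample J₀ (ℓ + 1) f) - sample J₀ L f) := by
      rw [pred_comp d n J₀ h1 hℓ, pred_one_step, map_sub, LinearMap.comp_apply]
      abel
    have hm := mesh_pos hJpos (ℓ + 1)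
    have hpow : 2 * mesh J₀ (ℓ + 1) ^ (n + 1) ≤ mesh J₀ ℓ ^ (n + 1) := by
      rw [mesh_eq_two_mul J₀ ℓ, mul_pow]
      refine mul_le_mul_of_nonneg_right ?_ (by positivity)
      calc (2 : ℝ) = 2 ^ 1 := by norm_num
        _ ≤ 2 ^ (n + 1) := pow_le_pow_right₀ (by norm_num) (by omega)
    have hK : 0 ≤ stabilityConst n ^ d * E := by positivity
    rw [hsplit]
    calc _ ≤ _ + _ := norm_add_le _ _
      _ ≤ stabilityConst n ^ d * (E * mesh J₀ ℓ ^ (n + 1))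
          + 2 * (stabilityConst n ^ d * E) * mesh J₀ (ℓ + 1) ^ (n + 1) :=
        add_le_add (hstep.trans (mul_le_mul_of_nonneg_left (hE ℓ) (by positivity))) ih
      _ ≤ 2 * (stabilityConst n ^ d * E) * mesh J₀ ℓ ^ (n + 1) := by nlinarith

/-! ### Second-order estimates for the objective -/

section SecondOrder

variable {E : Type*} [NormedAddCommGroup E] [NormedSpace ℝ E]

lemma hasDerivAt_along_line {F : E → ℝ} (hF : ContDiff ℝ 2 F) (x v : E) (t : ℝ) :
    HasDerivAt (fun t : ℝ => F (x + t • v)) (fderiv ℝ F (x + t • v) v) t := by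
  have hline : HasDerivAt (fun t : ℝ => x + t • v) v t := by
    simpa using ((hasDerivAt_id t).smul_const v).const_add x
  exact ((hF.differentiable (by norm_num)) (x + t • v)).hasFDerivAt.comp_hasDerivAt t hline

lemma exists_second_order_taylor {F : E → ℝ} (hF : ContDiff ℝ 2 F) (x v : E) :
    ∃ t ∈ Ioo (0 : ℝ) 1, F (x + v)
      = F x + fderiv ℝ F x v + iteratedFDeriv ℝ 2 F (x + t • v) (fun _ => v) / 2 := by
  set φ : ℝ → ℝ := fun t => F (x + t • v) with hφ
  have h1 : ∀ t, HasDerivAt φ (fderiv ℝ F (x + t • v) v) t := hasDerivAt_along_line hF x v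
  have hdφ : deriv φ = fun t => fderiv ℝ F (x + t • v) v := funext fun t => (h1 t).deriv
  have h2 : ∀ t, HasDerivAt (deriv φ) (iteratedFDeriv ℝ 2 F (x + t • v) (fun _ => v)) t := by
    intro t
    have hline : HasDerivAt (fun t : ℝ => x + t • v) v t := by
      simpa using ((hasDerivAt_id t).smul_const v).const_add x
    have hd : Differentiable ℝ (fderiv ℝ F) :=
      (hF.fderiv_right (m := 1) (by norm_num)).differentiable (by norm_num)
    have h3 : HasDerivAt (fun t : ℝ => fderiv ℝ F (x + t • v))
        (fderiv ℝ (fderiv ℝ F) (x + t • v) v) t :=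
      (hd (x + t • v)).hasFDerivAt.comp_hasDerivAt t hline
    have h4 := h3.clm_apply (hasDerivAt_const t v)
    rw [map_zero, add_zero] at h4
    rw [hdφ, iteratedFDeriv_two_apply]
    exact h4
  have hc : ContDiff ℝ 2 φ := hF.comp (by fun_prop)
  obtain ⟨t, ht, h⟩ := taylor_mean_remainder_lagrange_iteratedDeriv (n := 1)
    (zero_ne_one (α := ℝ)) (f := φ) (by exact_mod_cast hc.contDiffOn)
  rw [uIoo_of_le zero_le_one] at ht
  refine ⟨t, ht, ?_⟩
  rw [uIcc_of_le zero_le_one, taylorWithinEval_succ, taylor_within_zero_eval,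
    iteratedDerivWithin_one, (h1 0).hasDerivWithinAt.derivWithin
      (uniqueDiffOn_Icc zero_lt_one 0 (by simp)),
    show iteratedDeriv (1 + 1) φ t = deriv (deriv φ) t by
      rw [iteratedDeriv_succ, iteratedDeriv_one], (h2 t).deriv] at h
  simp [hφ] at h
  linarith

lemma fderiv_apply_eq_zero_of_forall_le {F : E → ℝ} (hF : ContDiff ℝ 2 F) {x v : E}
    (h : ∀ t : ℝ, F x ≤ F (x + t • v)) : fderiv ℝ F x v = 0 := by
  have h1 := hasDerivAt_along_line hF x v 0
  have hmin : IsLocalMin (fun t : ℝ => F (x + t • v)) 0 :=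
    Eventually.of_forall fun t => by simpa using h t
  simpa using hmin.hasDerivAt_eq_zero h1

end SecondOrder

lemma hessForm_smul {d J : ℕ} (F : GridFn d J → ℝ) (ξ x : GridFn d J) (c : ℝ) :
    hessForm F ξ (c • x) = c ^ 2 * hessForm F ξ x := by
  rw [hessForm, ContinuousMultilinearMap.map_smul_univ (iteratedFDeriv ℝ 2 F ξ)
    (fun _ => c) (fun _ => x)]
  simp [hessForm]

lemma continuous_hessForm {d J : ℕ} {F : GridFn d J → ℝ} (hF : ContDiff ℝ 2 F) :
    Continuous fun p : GridFn d J × GridFn d J => hessForm F p.1 p.2 := by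
  have hc : Continuous (fderiv ℝ (fderiv ℝ F)) :=
    (hF.fderiv_right (m := 1) (by norm_num)).continuous_fderiv (by norm_num)
  simp only [hessForm, iteratedFDeriv_two_apply]
  exact ((hc.comp continuous_fst).clm_apply continuous_snd).clm_apply continuous_snd

/-- By homogeneity only unit vectors matter, so for compact `D` the quotients form a compact set and
the infimum is attained, hence positive. -/
lemma hessQuotients_eq_image {d J : ℕ} (F : GridFn d J → ℝ) (D : Set (GridFn d J)) :
    hessQuotients F D = (fun p : GridFn d J × GridFn d J => hessForm F p.1 p.2)
      '' (D ×ˢ Metric.sphere 0 1) := by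
  ext r
  constructor
  · rintro ⟨ξ, hξ, x, hx, rfl⟩
    refine ⟨(ξ, ‖x‖⁻¹ • x), ⟨hξ, ?_⟩, ?_⟩
    · simp [norm_smul, norm_ne_zero_iff.2 hx]
    · simp only [hessForm_smul]
      rw [inv_pow, inv_mul_eq_div]
  · rintro ⟨⟨ξ, x⟩, ⟨hξ, hx⟩, rfl⟩
    have hx1 : ‖x‖ = 1 := by simpa using hx
    exact ⟨ξ, hξ, x, norm_ne_zero_iff.1 (by rw [hx1]; exact one_ne_zero), by simp [hx1]⟩

lemma isCompact_hessQuotients {d J : ℕ} {F : GridFn d J → ℝ} (hF : ContDiff ℝ 2 F)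
    {D : Set (GridFn d J)} (hD : IsCompact D) : IsCompact (hessQuotients F D) := by
  rw [hessQuotients_eq_image]
  exact (hD.prod (isCompact_sphere _ _)).image (continuous_hessForm hF)

lemma hessQuotients_nonempty {d J : ℕ} (F : GridFn d J → ℝ) {D : Set (GridFn d J)}
    (hD : D.Nonempty) : (hessQuotients F D).Nonempty :=
  let ⟨ξ, hξ⟩ := hD
  ⟨_, ξ, hξ, 1, one_ne_zero, rfl⟩

lemma rhoMin_pos {d J : ℕ} {F : GridFn d J → ℝ} (hF : ContDiff ℝ 2 F)
    (hpos : ∀ ξ x, x ≠ 0 → 0 < hessForm F ξ x) {D : Set (GridFn d J)} (hD : IsCompact D)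
    (hne : D.Nonempty) : 0 < rhoMin F D := by
  obtain ⟨ξ, -, x, hx, h⟩ := (isCompact_hessQuotients hF hD).sInf_mem
    (hessQuotients_nonempty F hne)
  rw [rhoMin, h]
  have := norm_pos_iff.2 hx
  have := hpos ξ x hx
  positivity

lemma rhoMin_mul_le_hessForm {d J : ℕ} {F : GridFn d J → ℝ} (hF : ContDiff ℝ 2 F)
    {D : Set (GridFn d J)} (hD : IsCompact D) {ξ : GridFn d J} (hξ : ξ ∈ D) (x : GridFn d J) :
    rhoMin F D * ‖x‖ ^ 2 ≤ hessForm F ξ x := by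
  rcases eq_or_ne x 0 with rfl | hx
  · have h0 : hessForm F ξ 0 = 0 := by simpa using hessForm_smul F ξ 0 0
    simp [h0]
  · have := norm_pos_iff.2 hx
    rw [← le_div_iff₀ (by positivity)]
    exact csInf_le (isCompact_hessQuotients hF hD).bddBelow ⟨ξ, hξ, x, hx, rfl⟩

lemma hessForm_le_rhoMax_mul {d J : ℕ} {F : GridFn d J → ℝ} (hF : ContDiff ℝ 2 F)
    {D : Set (GridFn d J)} (hD : IsCompact D) {ξ : GridFn d J} (hξ : ξ ∈ D) (x : GridFn d J) :
    hessForm F ξ x ≤ rhoMax F D * ‖x‖ ^ 2 := by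
  rcases eq_or_ne x 0 with rfl | hx
  · have h0 : hessForm F ξ 0 = 0 := by simpa using hessForm_smul F ξ 0 0
    simp [h0]
  · have := norm_pos_iff.2 hx
    rw [← div_le_iff₀ (by positivity)]
    exact le_csSup (isCompact_hessQuotients hF hD).bddAbove ⟨ξ, hξ, x, hx, rfl⟩

lemma rhoMin_le_rhoMax {d J : ℕ} {F : GridFn d J → ℝ} (hF : ContDiff ℝ 2 F)
    {D : Set (GridFn d J)} (hD : IsCompact D) : rhoMin F D ≤ rhoMax F D :=
  Real.sInf_le_sSup _ (isCompact_hessQuotients hF hD).bddBelow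
    (isCompact_hessQuotients hF hD).bddAbove

lemma one_le_sqrt_rho_div {d J : ℕ} {F : GridFn d J → ℝ} (hF : ContDiff ℝ 2 F)
    (hpos : ∀ ξ x, x ≠ 0 → 0 < hessForm F ξ x) {D : Set (GridFn d J)} (hD : IsCompact D)
    (hne : D.Nonempty) : 1 ≤ √(rhoMax F D / rhoMin F D) :=
  Real.one_le_sqrt.2 ((one_le_div (rhoMin_pos hF hpos hD hne)).2 (rhoMin_le_rhoMax hF hD))

/-- A point with a smaller objective value is closer to the minimizer, up to the condition
number. -/
lemma norm_sub_le_of_le {d J : ℕ} {F : GridFn d J → ℝ} (hF : ContDiff ℝ 2 F)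
    (hpos : ∀ ξ x, x ≠ 0 → 0 < hessForm F ξ x) {D : Set (GridFn d J)} (hD : IsCompact D)
    (hconv : Convex ℝ D) {z w y : GridFn d J} (hz : IsMinOn F univ z) (hzD : z ∈ D)
    (hwD : w ∈ D) (hyD : y ∈ D) (hwy : F w ≤ F y) :
    ‖z - w‖ ≤ √(rhoMax F D / rhoMin F D) * ‖y - z‖ := by
  have hρ := rhoMin_pos hF hpos hD ⟨z, hzD⟩
  -- The gradient vanishes at `z`, and convexity of `D` keeps the intermediate Taylor point in `D`.
  have key : ∀ p ∈ D, ∃ ξ ∈ D, F p = F z + hessForm F ξ (p - z) / 2 := fun p hp => by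
    obtain ⟨t, ht, h⟩ := exists_second_order_taylor hF z (p - z)
    rw [fderiv_apply_eq_zero_of_forall_le hF fun t => hz (mem_univ _), add_sub_cancel,
      add_zero] at h
    exact ⟨_, hconv.add_smul_sub_mem hzD hp ⟨ht.1.le, ht.2.le⟩, h⟩
  obtain ⟨ξ, hξ, hw⟩ := key w hwD
  obtain ⟨η, hη, hy⟩ := key y hyD
  have h1 := rhoMin_mul_le_hessForm hF hD hξ (w - z)
  have h2 := hessForm_le_rhoMax_mul hF hD hη (y - z)
  have h3 : ‖w - z‖ ^ 2 ≤ rhoMax F D / rhoMin F D * ‖y - z‖ ^ 2 := by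
    rw [div_mul_eq_mul_div, le_div_iff₀ hρ]
    linarith
  rw [norm_sub_rev]
  calc ‖w - z‖ = √(‖w - z‖ ^ 2) := (Real.sqrt_sq (norm_nonneg _)).symm
    _ ≤ √(rhoMax F D / rhoMin F D * ‖y - z‖ ^ 2) := Real.sqrt_le_sqrt h3
    _ = √(rhoMax F D / rhoMin F D) * ‖y - z‖ := by
      rw [Real.sqrt_mul' _ (by positivity), Real.sqrt_sq (norm_nonneg _)]

/-! ### The multilevel strategy -/

lemma exists_isMinOn_levelObjective {d n J₀ L k : ℕ} (h : k ≤ L)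
    {F : GridFn d (cells J₀ L) → ℝ} (hF : ContDiff ℝ 2 F)
    (hcoer : Tendsto F (Bornology.cobounded _) atTop) (z : GridFn d (cells J₀ L)) :
    ∃ e, IsMinOn (levelObjective n J₀ h F z) univ e := by
  have hcont : Continuous (levelObjective n J₀ h F z) :=
    hF.continuous.comp (continuous_const.add (LinearMap.continuous_of_finiteDimensional _))
  have hcob : Tendsto (fun e : GridFn d (cells J₀ k) => z + pred d n J₀ h e)
      (Bornology.cobounded _) (Bornology.cobounded _) := by
    rw [← tendsto_norm_atTop_iff_cobounded]
    have h1 : Tendsto (fun e : GridFn d (cells J₀ k) => ‖e‖ - ‖z‖)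
        (Bornology.cobounded _) atTop :=
      tendsto_atTop_add_const_right _ _ tendsto_norm_cobounded_atTop
    refine tendsto_atTop_mono (fun e => ?_) h1
    have h2 := norm_le_norm_pred (n := n) h e
    have h3 : ‖pred d n J₀ h e‖ ≤ ‖z + pred d n J₀ h e‖ + ‖z‖ := by
      simpa using norm_sub_le (z + pred d n J₀ h e) z
    linarith
  obtain ⟨e, he⟩ := hcont.exists_forall_le (by
    rw [← Metric.cobounded_eq_cocompact]
    exact hcoer.comp hcob)
  exact ⟨e, fun x _ => he x⟩

lemma isMinOn_levelObjective_unique {d n J₀ L k : ℕ} (h : k ≤ L)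
    {F : GridFn d (cells J₀ L) → ℝ} (hF : ContDiff ℝ 2 F)
    (hpos : ∀ ξ x, x ≠ 0 → 0 < hessForm F ξ x) {z : GridFn d (cells J₀ L)}
    {e e' : GridFn d (cells J₀ k)} (he : IsMinOn (levelObjective n J₀ h F z) univ e)
    (he' : IsMinOn (levelObjective n J₀ h F z) univ e') : e = e' := by
  by_contra hne
  set v := pred d n J₀ h (e' - e) with hv
  have hv0 : v ≠ 0 := by
    rw [← norm_pos_iff]
    exact (norm_pos_iff.2 (sub_ne_zero.2 (Ne.symm hne))).trans_le (norm_le_norm_pred h _)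
  have hline : ∀ t : ℝ, z + pred d n J₀ h e + t • v = z + pred d n J₀ h (e + t • (e' - e)) :=
    fun t => by rw [hv, map_add, map_smul, add_assoc]
  obtain ⟨t, -, ht⟩ := exists_second_order_taylor hF (z + pred d n J₀ h e) v
  rw [fderiv_apply_eq_zero_of_forall_le hF fun t => by rw [hline]; exact he (mem_univ _)] at ht
  have h1 : z + pred d n J₀ h e + v = z + pred d n J₀ h e' := by
    rw [hv, map_sub]; abel
  rw [h1] at ht
  have h2 : F (z + pred d n J₀ h e') ≤ F (z + pred d n J₀ h e) := he' (mem_univ e)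
  have h3 := hpos (z + pred d n J₀ h e + t • v) v hv0
  rw [hessForm] at h3
  linarith

lemma exists_isOutcome {d n J₀ L : ℕ} {F : GridFn d (cells J₀ L) → ℝ} (hF : ContDiff ℝ 2 F)
    (hcoer : Tendsto F (Bornology.cobounded _) atTop) (zbar : GridFn d (cells J₀ L)) :
    ∃ s : Iterates d J₀ L, IsOutcome n J₀ F zbar s := by
  choose e he using fun (k : ℕ) (h : k ≤ L) (z : GridFn d (cells J₀ L)) =>
    exists_isMinOn_levelObjective (n := n) h hF hcoer z
  set Z : ℕ → GridFn d (cells J₀ L) := fun k => Nat.rec zbar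
    (fun k z => if h : k ≤ L then z + pred d n J₀ h (e k h z) else z) k with hZ
  refine ⟨⟨fun i => Z i, fun k => e k k.is_le (Z k)⟩, rfl, fun k => ⟨he k k.is_le (Z k), ?_⟩⟩
  have : Z ((k : ℕ) + 1) = if h : (k : ℕ) ≤ L then Z k + pred d n J₀ h (e k h (Z k)) else Z k := rfl
  rw [dif_pos k.is_le] at this
  exact this

lemma isOutcome_unique {d n J₀ L : ℕ} {F : GridFn d (cells J₀ L) → ℝ} (hF : ContDiff ℝ 2 F)
    (hpos : ∀ ξ x, x ≠ 0 → 0 < hessForm F ξ x) {zbar : GridFn d (cells J₀ L)}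
    {s s' : Iterates d J₀ L} (hs : IsOutcome n J₀ F zbar s) (hs' : IsOutcome n J₀ F zbar s') :
    s = s' := by
  have hε : ∀ k : Fin (L + 1), s.z k.castSucc = s'.z k.castSucc → s.ε k = s'.ε k := fun k h => by
    have h1 := (hs.2 k).1
    rw [h] at h1
    exact isMinOn_levelObjective_unique k.is_le hF hpos h1 (hs'.2 k).1
  have hz : ∀ i : Fin (L + 2), s.z i = s'.z i := fun i => by
    induction i using Fin.induction with
    | zero => rw [hs.1, hs'.1]
    | succ k ih => rw [(hs.2 k).2, (hs'.2 k).2, ih, hε k ih]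
  cases s with
  | mk z ε =>
    cases s' with
    | mk z' ε' =>
      congr 1
      · exact funext hz
      · exact funext fun k => hε k (hz _)

/-- All corrections up to level `ℓ` lie in the range of `P_ℓ^L`, since `P_k^L = P_ℓ^L P_k^ℓ`. -/
lemma IsOutcome.exists_eq_add_pred {d n J₀ L : ℕ} {F : GridFn d (cells J₀ L) → ℝ}
    {zbar : GridFn d (cells J₀ L)} {s : Iterates d J₀ L} (hs : IsOutcome n J₀ F zbar s)
    (i : Fin (L + 2)) {ℓ : ℕ} (hℓ : ℓ ≤ L) (hi : (i : ℕ) ≤ ℓ) :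
    ∃ e : GridFn d (cells J₀ ℓ), s.z i = zbar + pred d n J₀ hℓ e := by
  induction i using Fin.induction with
  | zero => exact ⟨0, by rw [hs.1, map_zero, add_zero]⟩
  | succ k ih =>
    rw [Fin.val_succ] at hi
    have hk : (k : ℕ) ≤ ℓ := by omega
    obtain ⟨e, he⟩ := ih hk
    refine ⟨e + pred d n J₀ hk (s.ε k), ?_⟩
    rw [(hs.2 k).2, he, map_add, ← LinearMap.comp_apply, ← pred_comp, add_assoc]

/-- The sub-optimal solution does at least as well as the prediction of any coarse correction of
the initial guess. -/
lemma IsOutcome.le_of_pred {d n J₀ L : ℕ} {F : GridFn d (cells J₀ L) → ℝ}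
    {zbar : GridFn d (cells J₀ L)} {s : Iterates d J₀ L} (hs : IsOutcome n J₀ F zbar s)
    (ℓ : Fin (L + 1)) (u : GridFn d (cells J₀ ℓ)) :
    F (s.z ℓ.succ) ≤ F (zbar + pred d n J₀ ℓ.is_le u) := by
  obtain ⟨e, he⟩ := hs.exists_eq_add_pred ℓ.castSucc ℓ.is_le le_rfl
  have h : F (s.z ℓ.castSucc + pred d n J₀ ℓ.is_le (s.ε ℓ))
      ≤ F (s.z ℓ.castSucc + pred d n J₀ ℓ.is_le (u - e)) := (hs.2 ℓ).1 (mem_univ (u - e))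
  rw [← (hs.2 ℓ).2] at h
  convert h using 2
  rw [he, map_sub]
  abel

lemma norm_sample_le {d J₀ L : ℕ} (hJ₀ : 0 < J₀) {f : (Fin d → ℝ) → ℝ} {B : ℝ} (hB : 0 ≤ B)
    (hf : ∀ x ∈ Icc (0 : Fin d → ℝ) 1, ‖f x‖ ≤ B) : ‖sample J₀ L f‖ ≤ B :=
  (pi_norm_le_iff_of_nonneg hB).2 fun i => hf _ (node_mem_cube hJ₀ i)

end MROpt

/-! ### The error estimates for the sub-optimal solutions -/

theorem mainTheorem2
    (d n J₀ : ℕ) (hn : Odd n) (hJ₀ : n ≤ J₀)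
    (f g : (Fin d → ℝ) → ℝ)
    (hf : ContDiffOn ℝ (n + 1 : ℕ) f (Set.Icc 0 1))
    (hg : ContDiffOn ℝ (n + 1 : ℕ) g (Set.Icc 0 1)) :
    ∃ C : ℝ, 0 < C ∧
      ∀ (L : ℕ) (F : MROpt.GridFn d (MROpt.cells J₀ L) → ℝ)
        (zbar zmin : MROpt.GridFn d (MROpt.cells J₀ L)),
        ContDiff ℝ 2 F →
        ConvexOn ℝ Set.univ F →
        Filter.Tendsto F (Bornology.cobounded _) Filter.atTop →
        (∀ ξ x, x ≠ 0 → 0 < MROpt.hessForm F ξ x) →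
        IsMinOn F Set.univ zmin →
        zbar = MROpt.sample J₀ L f →
        zmin = MROpt.sample J₀ L g →
        (∃! s : MROpt.Iterates d J₀ L, MROpt.IsOutcome n J₀ F zbar s) ∧
        ∀ s : MROpt.Iterates d J₀ L, MROpt.IsOutcome n J₀ F zbar s →
          ∀ D : Set (MROpt.GridFn d (MROpt.cells J₀ L)),
            IsCompact D → Convex ℝ D →
            (∀ k : Fin (L + 2), s.z k ∈ D) →
            (∀ (ℓ : ℕ) (hℓ : ℓ ≤ L),
              zbar + MROpt.pred d n J₀ hℓ (MROpt.sample J₀ ℓ g - MROpt.sample J₀ ℓ f) ∈ D) →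
            ∀ ℓ : Fin (L + 1), (ℓ : ℕ) < L →
              ‖zmin - s.z ℓ.succ‖
                ≤ C * √(MROpt.rhoMax F D / MROpt.rhoMin F D)
                    * MROpt.mesh J₀ ((ℓ : ℕ) + 1) ^ (n + 1) ∧
              ‖s.z ℓ.succ - s.z ℓ.castSucc‖
                ≤ C * √(MROpt.rhoMax F D / MROpt.rhoMin F D)
                    * MROpt.mesh J₀ (ℓ : ℕ) ^ (n + 1) ∧
              ‖s.ε ℓ‖
                ≤ C * √(MROpt.rhoMax F D / MROpt.rhoMin F D)
                    * MROpt.mesh J₀ (ℓ : ℕ) ^ (n + 1) := by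
  have hJpos : 0 < J₀ := hn.pos.trans_le hJ₀
  have hu : ContDiffOn ℝ (n + 1 : ℕ) (g - f) (Set.Icc 0 1) := hg.sub hf
  obtain ⟨E, hE0, hE⟩ := MROpt.exists_norm_pred_sample_sub_le hn hJ₀ hu
  obtain ⟨B, hB⟩ := isCompact_Icc.exists_bound_of_continuousOn hu.continuousOn
  have hB0 : 0 ≤ B := (norm_nonneg _).trans (hB 0 (by simp))
  -- `E 2^(n+1)` pays for passing from `h_ℓ` to `h_{ℓ+1}`, the second `E` for the other term in the
  -- increment, `B J₀^(n+1)` for the initial guess; the `1` ensures positivity.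
  refine ⟨E * 2 ^ (n + 1) + E + B * (J₀ : ℝ) ^ (n + 1) + 1, by positivity, ?_⟩
  intro L F zbar zmin hF _ hcoer hpos hmin hzbar hzmin
  obtain ⟨s₀, hs₀⟩ := MROpt.exists_isOutcome (n := n) hF hcoer zbar
  refine ⟨⟨s₀, hs₀, fun s hs => MROpt.isOutcome_unique hF hpos hs hs₀⟩, ?_⟩
  intro s hs D hD hconv hzD hyD ℓ hℓ
  have hdiff : ∀ k, MROpt.sample (d := d) J₀ k (g - f)
      = MROpt.sample J₀ k g - MROpt.sample J₀ k f := fun k => rfl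
  -- At level `L` the prediction is the identity, so the point assumed in `D` is `zmin` itself.
  have hminD : zmin ∈ D := by
    have h := hyD L le_rfl
    rw [MROpt.pred_self, LinearMap.id_apply, hzbar, add_sub_cancel, ← hzmin] at h
    exact h
  set R := √(MROpt.rhoMax F D / MROpt.rhoMin F D) with hR
  have hR1 : 1 ≤ R := MROpt.one_le_sqrt_rho_div hF hpos hD ⟨zmin, hminD⟩
  have hR0 : 0 ≤ R := zero_le_one.trans hR1
  have hm := MROpt.mesh_pos hJpos
  have hclose : ∀ k : Fin (L + 1),
      ‖zmin - s.z k.succ‖ ≤ R * (E * MROpt.mesh J₀ k ^ (n + 1)) := fun k => by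
    refine (MROpt.norm_sub_le_of_le hF hpos hD hconv hmin hminD (hzD k.succ)
      (hyD k k.is_le) (hs.le_of_pred k _)).trans (mul_le_mul_of_nonneg_left ?_ hR0)
    refine le_of_eq_of_le ?_ (hE k L k.is_le)
    rw [hdiff, hdiff, hzbar, hzmin]
    congr 1
    abel
  have hpow : ∀ k, MROpt.mesh J₀ k ^ (n + 1)
      = 2 ^ (n + 1) * MROpt.mesh J₀ (k + 1) ^ (n + 1) := fun k => by
    rw [MROpt.mesh_eq_two_mul J₀ k, mul_pow]
  -- At level `0` no previous estimate exists: the error is at most `B = B J₀^(n+1) h_0^(n+1)`, and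
  -- `R ≥ 1`. Later levels use `hclose` one level down.
  have hstart : ‖zmin - s.z ℓ.castSucc‖
      ≤ R * ((E * 2 ^ (n + 1) + B * (J₀ : ℝ) ^ (n + 1)) * MROpt.mesh J₀ ℓ ^ (n + 1)) := by
    have hmℓ := hm ℓ
    obtain ⟨k, hk⟩ := ℓ
    cases k with
    | zero =>
      have h0 : s.z (Fin.castSucc ⟨0, hk⟩) = zbar := hs.1
      have h1 : (J₀ : ℝ) ^ (n + 1) * MROpt.mesh J₀ 0 ^ (n + 1) = 1 := by
        have : (J₀ : ℝ) ≠ 0 := by exact_mod_cast hJpos.ne'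
        rw [← mul_pow, MROpt.mesh]
        simp [this]
      rw [h0, hzbar, hzmin, ← hdiff]
      have h2 : 0 ≤ E * 2 ^ (n + 1) * MROpt.mesh J₀ 0 ^ (n + 1) := by
        have := hm 0
        positivity
      have h3 := MROpt.norm_sample_le (L := L) hJpos hB0 hB
      calc _ ≤ 1 * B := by rw [one_mul]; exact h3
        _ ≤ R * (E * 2 ^ (n + 1) * MROpt.mesh J₀ 0 ^ (n + 1) + B) := by gcongr; linarith
        _ = _ := by
          congr 1
          linear_combination -B * h1
    | succ k =>
      refine (hclose ⟨k, by omega⟩).trans (mul_le_mul_of_nonneg_left ?_ hR0)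
      have h1 : 0 ≤ B * (J₀ : ℝ) ^ (n + 1) * MROpt.mesh J₀ (k + 1) ^ (n + 1) := by
        have := hm (k + 1)
        positivity
      simp only [hpow k]
      linarith
  have hinc : ‖s.z ℓ.succ - s.z ℓ.castSucc‖
      ≤ (E * 2 ^ (n + 1) + E + B * (J₀ : ℝ) ^ (n + 1) + 1) * R
        * MROpt.mesh J₀ ℓ ^ (n + 1) := by
    have h1 : 0 ≤ R * MROpt.mesh J₀ ℓ ^ (n + 1) := by
      have := hm ℓ
      positivity
    have h2 := norm_sub_le (zmin - s.z ℓ.castSucc) (zmin - s.z ℓ.succ)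
    rw [sub_sub_sub_cancel_left] at h2
    have h3 := hclose ℓ
    linarith
  refine ⟨?_, hinc, ?_⟩
  · have h1 := hclose ℓ
    have h2 : 0 ≤ R * MROpt.mesh J₀ ((ℓ : ℕ) + 1) ^ (n + 1) := by
      have := hm ((ℓ : ℕ) + 1)
      positivity
    have h3 : 0 ≤ (E + B * (J₀ : ℝ) ^ (n + 1) + 1)
        * (R * MROpt.mesh J₀ ((ℓ : ℕ) + 1) ^ (n + 1)) := by positivity
    rw [hpow] at h1
    linarith
  -- The increment is the predicted correction, whose norm dominates that of the correction.
  · refine (MROpt.norm_le_norm_pred (n := n) ℓ.is_le (s.ε ℓ)).trans (le_of_eq_of_le ?_ hinc)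
    rw [(hs.2 ℓ).2, add_sub_cancel_left]
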